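/- Let $M\ge 1$ be an integer, $\lambda>0$, $\epsilon>0$, $L_{\max}>0$, $0<\delta<1/2$ and $h_{ab}\in\mathbb C\setminus\{0\}$. Let $\mathbf h_{aw}$ be a random vector in $\mathbb C^M$ (Rayleigh fading) whose squared entries $|h_{aw,i}|^2$ are independent and exponentially distributed with mean $1/\lambda$. For $P_a>0$, conditionally on $\mathbf h_{aw}$, Willie's $n$ observation vectors are independent, each distributed as $\mathcal{CN}(\mathbf 0,\mathbf I_M)$ under $H_0$ (joint law $\mathbb P_0^{n}$) and as $\mathcal{CN}(\mathbf 0,P_a\mathbf h_{aw}\mathbf h_{aw}^H+\mathbf I_M)$ under $H_1$ (joint law $\mathbb P_1^{n}$). For $L>0$ let $$R(L,P_a)=\log_2(1+P_a|h_{ab}|^2)-\sqrt{\tfrac1L\Big(1-\tfrac1{(1+P_a|h_{ab}|^2)^2}\Big)}\;\frac{Q^{-1}(\delta)}{\ln 2},$$ where $Q$ is the standard Gaussian tail function, and let the throughput be $T(L,P_a)=L\,R(L,P_a)(1-\delta)$. Consider the problem P1: maximize $T(L,P_a)$ over real $L>0$ and $P_a>0$ subject to $L\,\mathbb E\big[\mathcal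 D(\mathbb P_0\|\mathbb P_1)\big]\le 2\epsilon^2$ and $L\le L_{\max}$, where $\mathcal D$ is the Kullback-Leibler divergence and $\mathbb P_i=\mathbb P_i^1$. Define, for $P_a>0$, $$g(P_a)=\frac{\lambda^M}{(M-1)!}\left[\frac1{\lambda^M}\,G^{3,1}_{2,3}\!\left(\left.\begin{matrix}0;\,1\\ 0,0,M\end{matrix}\;\right|\frac{\lambda}{P_a}\right)-P_a^{-M}\,\Gamma(M+1)\,e^{\lambda/P_a}\,\Gamma\!\left(-M,\frac{\lambda}{P_a}\right)\right],$$ where $\Gamma(a,z)=\int_z^\infty t^{a-1}e^{-t}\,dt$ is the upper incomplete Gamma function and $G^{3,1}_{2,3}$ is the Meijer G-function $$\frac1{2\pi i}\int_{c-i\infty}^{c+i\infty}\frac{\Gamma(-s)^2\,\Gamma(M-s)\,\Gamma(1+s)}{\Gamma(1-s)}\,z^s\,ds,\qquad -1<c<0,$$ at $z=\lambda/P_a$ (which is a real number). Put $$L_M^*(P_a)=\min\Big(L_{\max},\frac{2\epsilon^2}{g(P_a)}\Big).$$ Then: (i) $\|\mathbf h_{aw}\|^2$ has the Erlang distribution with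 density $\lambda^M x^{M-1}e^{-\lambda x}/(M-1)!$, $x\ge 0$, and for every $P_a>0$ one has $g(P_a)>0$ and $\mathbb E\big[\mathcal D(\mathbb P_0^{n}\|\mathbb P_1^{n})\big]=n\,g(P_a)$ for every integer $n\ge 0$. (ii) For every $P_a>0$, a pair $(L,P_a)$ with $L>0$ is feasible for P1 if and only if $L\le L_M^*(P_a)$; and an integer $n\ge0$ satisfies $\mathbb E[\mathcal D(\mathbb P_0^{n}\|\mathbb P_1^{n})]\le2\epsilon^2$ and $n\le L_{\max}$ if and only if $n\le L_M^*(P_a)$. (iii) For every fixed $P_a>0$, a blocklength $L$ maximizes $T(\cdot,P_a)$ over all $L$ that are feasible for this $P_a$ if and only if $L=L_M^*(P_a)$ and $R(L,P_a)\ge 0$. In particular, whenever the rate at $L_M^*(P_a)$ is non-negative, $L_M^*(P_a)$ is the unique throughput-optimal blocklength. (iv) A pair $(L,P_a)$ solves P1 if and only if $L=L_M^*(P_a)$ and $P_a$ solves the one-dimensional problem of maximizing $T(L_M^*(P),P)$ over $P>0$. -/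

import Mathlib

open MeasureTheory ProbabilityTheory Set

open scoped ENNReal

noncomputable section

namespace Covert

/-- The squared Euclidean norm of a complex vector. -/
def normSqVec {M : ℕ} (h : Fin M → ℂ) : ℝ := ∑ i, ‖h i‖ ^ 2

/-- The density `exp (- yᴴ K⁻¹ y) / (π ^ M * det K)` of the circularly symmetric complex Gaussian
distribution with mean zero and (Hermitian positive definite) covariance matrix `K`. -/
def complexGaussianPDF {M : ℕ} (K : Matrix (Fin M) (Fin M) ℂ) (y : Fin M → ℂ) : ℝ :=
  Real.exp (-(dotProduct (star y) (Matrix.mulVec K⁻¹ y)).re) / (Real.pi ^ M * K.det.re)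

/-- The circularly symmetric complex Gaussian distribution `CN(0, K)` on `ℂ ^ M`, for a positive
definite covariance matrix `K`. -/
def complexGaussian {M : ℕ} (K : Matrix (Fin M) (Fin M) ℂ) : Measure (Fin M → ℂ) :=
  volume.withDensity fun y => ENNReal.ofReal (complexGaussianPDF K y)

/-- The covariance matrix `P h hᴴ + I` of one observation when Alice transmits with power `P`
over the channel `h`. -/
def covTransmit {M : ℕ} (P : ℝ) (h : Fin M → ℂ) : Matrix (Fin M) (Fin M) ℂ :=
  (P : ℂ) • Matrix.vecMulVec h (star h) + 1

/-- The law of Willie's `n` independent observations when Alice is silent. -/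
def lawSilent (M n : ℕ) : Measure (Fin n → Fin M → ℂ) :=
  Measure.pi fun _ => complexGaussian (1 : Matrix (Fin M) (Fin M) ℂ)

/-- The law of Willie's `n` independent observations when Alice transmits with power `P` over the
channel `h`. -/
def lawTransmit {M : ℕ} (n : ℕ) (P : ℝ) (h : Fin M → ℂ) : Measure (Fin n → Fin M → ℂ) :=
  Measure.pi fun _ => complexGaussian (covTransmit P h)

/-- The Kullback-Leibler divergence of Willie's `n` observations, silent from transmitting,
averaged over the random channel `h`. -/
def expectedKL {Ω : Type*} [MeasurableSpace Ω] (μ : Measure Ω) {M : ℕ} (h : Ω → Fin M → ℂ)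
    (P : ℝ) (n : ℕ) : ℝ≥0∞ :=
  ∫⁻ ω, InformationTheory.klDiv (lawSilent M n) (lawTransmit n P (h ω)) ∂μ

/-- Rayleigh fading: the channel gains `|h i|²` are independent and exponentially distributed with
rate `lam`, that is, with mean `1 / lam`. -/
structure IsRayleigh {Ω : Type*} [MeasurableSpace Ω] (μ : Measure Ω) {M : ℕ}
    (h : Ω → Fin M → ℂ) (lam : ℝ) : Prop where
  indep : iIndepFun (fun i ω => ‖h ω i‖ ^ 2) μ
  law : ∀ i, HasLaw (fun ω => ‖h ω i‖ ^ 2) (expMeasure lam) μ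

/-- The Gaussian tail function `Q(x)`. -/
def gaussianQ (x : ℝ) : ℝ := (gaussianReal 0 1).real (Ioi x)

/-- The inverse of the Gaussian tail function (meaningful on the range `(0, 1)` of `gaussianQ`). -/
def gaussianQInv (d : ℝ) : ℝ := Function.invFun gaussianQ d

/-- The channel coding rate in bits per channel use at blocklength `L`, transmit power `P`,
decoding error probability `d` and channel coefficient `hab`. -/
def codingRate (d : ℝ) (hab : ℂ) (L P : ℝ) : ℝ :=
  Real.logb 2 (1 + P * ‖hab‖ ^ 2)
    - Real.sqrt (1 / L * (1 - 1 / (1 + P * ‖hab‖ ^ 2) ^ 2)) * (gaussianQInv d / Real.log 2)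

/-- The throughput `L R (1 - d)`. -/
def throughput (d : ℝ) (hab : ℂ) (L P : ℝ) : ℝ := L * codingRate d hab L P * (1 - d)

/-- The feasible pairs (blocklength, power) of Alice's problem. The blocklength is a positive real
number; since the channel uses are independent and identically distributed, the divergence of `L`
channel uses is `L` times that of one channel use. -/
def feasible {Ω : Type*} [MeasurableSpace Ω] (μ : Measure Ω) {M : ℕ} (h : Ω → Fin M → ℂ)
    (eps Lmax : ℝ) : Set (ℝ × ℝ) :=
  {x | 0 < x.1 ∧ 0 < x.2 ∧
    ENNReal.ofReal x.1 * expectedKL μ h x.2 1 ≤ ENNReal.ofReal (2 * eps ^ 2) ∧ x.1 ≤ Lmax}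

/-- The vertical line `Re s = c` separates the poles of the factors `Γ (b - s)`, `b ∈ b₁`, (on its
right) from those of the factors `Γ (1 - a + s)`, `a ∈ a₁` (on its left). -/
def Separates (a₁ b₁ : List ℂ) (c : ℝ) : Prop :=
  (∀ b ∈ b₁, c < b.re) ∧ ∀ a ∈ a₁, a.re - 1 < c

/-- The integrand of the Mellin-Barnes integral of the Meijer G-function. -/
def meijerIntegrand (a₁ a₂ b₁ b₂ : List ℂ) (z s : ℂ) : ℂ :=
  ((b₁.map fun b => Complex.Gamma (b - s)).prod
      * (a₁.map fun a => Complex.Gamma (1 - a + s)).prod)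
    / ((b₂.map fun b => Complex.Gamma (1 - b + s)).prod
      * (a₂.map fun a => Complex.Gamma (a - s)).prod) * z ^ s

open scoped Classical in
/-- The Meijer G-function with upper parameters `a₁ ++ a₂` and lower parameters `b₁ ++ b₂`
(`m = length b₁`, `n = length a₁`), `1 / (2 π i)` times the integral of `meijerIntegrand` along an
upward vertical line that separates the two families of poles. By Cauchy's theorem the value does
not depend on the line. It is used only where such a line exists and the integral converges
absolutely. -/
def meijerG (a₁ a₂ b₁ b₂ : List ℂ) (z : ℂ) : ℂ :=
  if hc : ∃ c : ℝ, Separates a₁ b₁ c then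
    1 / (2 * Real.pi * Complex.I) *
      ∫ t : ℝ, meijerIntegrand a₁ a₂ b₁ b₂ z (hc.choose + t * Complex.I) * Complex.I
  else 0

/-- The upper incomplete Gamma function `Γ(a, z)`, for `z > 0` and any real `a`. -/
def upperGamma (a z : ℝ) : ℝ := ∫ t in Ioi z, t ^ (a - 1) * Real.exp (-t)

/-- The value `G(0; 1; 0, 0, M; ; lam / P)` of the Meijer G-function. -/
def meijerTerm (M : ℕ) (lam P : ℝ) : ℂ := meijerG [0] [1] [0, 0, (M : ℂ)] [] ((lam / P : ℝ) : ℂ)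

/-- The expected divergence per channel use, in closed form. -/
def g (M : ℕ) (lam P : ℝ) : ℝ :=
  lam ^ M / (Nat.factorial (M - 1) : ℝ) *
    (1 / lam ^ M * (meijerTerm M lam P).re
      - 1 / P ^ M * Real.Gamma ((M : ℝ) + 1) * Real.exp (lam / P)
        * upperGamma (-(M : ℝ)) (lam / P))

/-- The blocklength `min (Lmax, 2 eps² / g P)`. -/
def Lstar (M : ℕ) (lam eps Lmax P : ℝ) : ℝ := min Lmax (2 * eps ^ 2 / g M lam P)

end Covert

end

/-!
For a fixed channel vector `h`, the covariance matrix `K = P h hᴴ + I` has determinant `1 + x` and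
inverse `I - P / (1 + x) h hᴴ`, where `x = P ‖h‖²`. The log-likelihood ratio of one observation is
therefore `log (1 + x) - P / (1 + x) |hᴴ y|²`, and as `|hᴴ y|²` has mean `‖h‖²` under `CN(0, I)`, the
divergence per observation is `log (1 + x) - x / (1 + x)`; it is additive over independent
observations (`klDiv_lawSilent_lawTransmit`). That `CN(0, K)` has mass one is the linear change of
variables `y ↦ B y` with `K⁻¹ = Bᴴ B` (`integral_complexGaussianPDF`).

The divergence depends on `h` only through `‖h‖²`, which is a sum of independent exponential
variables, hence Erlang: the characteristic functions agree (`hasLaw_sum_gammaMeasure`). The average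
over the Erlang law splits into two integrals.
* The one of `P x / (1 + P x)` is the incomplete Gamma term: insert
  `Γ(M + 1) t ^ (-M - 1) = ∫ u ^ M exp (-u t) du` and interchange (`integral_erlang_div`).
* The one of `log (1 + P x)` is the Meijer G-function (`meijerTerm_eq`): the Mellin transform of
  `log (1 + u)` on `-1 < Re s < 0` is `π / (s sin (π s))`, which decays quadratically on vertical
  lines, so that Mellin inversion applies. Integrating the inversion formula against
  `x ^ (M - 1) exp (-lam x)` turns `x ^ (-s)` into `Γ(M - s) lam ^ (s - M)`, and the reflection
  formula identifies the result with the Mellin-Barnes integral.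

For fixed power the throughput is a positive multiple of `a L - b √L` with `a, b > 0`. It is negative
up to a point, with limit `0` at the origin, and increasing where it is non-negative, so on
`(0, S]` a maximum can only sit at `S`, and does so exactly when the value there is non-negative
(`isMaxOn_Ioc_iff`). For the joint problem it remains to exclude that the best value of the
one-dimensional problem is negative, in which case the joint problem would have no solution. This
holds because for large `P` the capacity grows like `log P`, while the covert blocklength decays
no faster than `1 / log P` (`exists_codingRate_Lstar_nonneg`).
-/

namespace Covert

open Filter Topology

open scoped ComplexOrder

/-! ### Complex Gaussian laws -/

lemma integral_exp_neg_norm_sq : ∫ z : ℂ, Real.exp (-‖z‖ ^ 2) = Real.pi := by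
  have h := Complex.integral_rpow_mul_exp_neg_rpow (p := 2) (q := 0) (by norm_num) (by norm_num)
  have e : (2 * Real.pi / 2) * Real.Gamma ((0 + 2) / 2) = Real.pi := by
    norm_num [Real.Gamma_one]
  rw [e] at h
  simpa using h

lemma integral_norm_sq_mul_exp_neg_norm_sq :
    ∫ z : ℂ, ‖z‖ ^ 2 * Real.exp (-‖z‖ ^ 2) = Real.pi := by
  have h := Complex.integral_rpow_mul_exp_neg_rpow (p := 2) (q := 2) (by norm_num) (by norm_num)
  have e : (2 * Real.pi / 2) * Real.Gamma ((2 + 2) / 2) = Real.pi := by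
    norm_num [Real.Gamma_two]
  rw [e] at h
  simpa using h

lemma integrable_exp_neg_norm_sq : Integrable fun z : ℂ => Real.exp (-‖z‖ ^ 2) :=
  .of_integral_ne_zero (by rw [integral_exp_neg_norm_sq]; exact Real.pi_ne_zero)

lemma integrable_norm_sq_mul_exp_neg_norm_sq :
    Integrable fun z : ℂ => ‖z‖ ^ 2 * Real.exp (-‖z‖ ^ 2) :=
  .of_integral_ne_zero (by rw [integral_norm_sq_mul_exp_neg_norm_sq]; exact Real.pi_ne_zero)

lemma integral_exp_neg_normSqVec (M : ℕ) :
    ∫ y : Fin M → ℂ, Real.exp (-normSqVec y) = Real.pi ^ M := by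
  have h := integral_fintype_prod_volume_eq_pow (ι := Fin M)
    (fun z : ℂ => Real.exp (-‖z‖ ^ 2))
  rw [integral_exp_neg_norm_sq, Fintype.card_fin] at h
  simpa [← Real.exp_sum, normSqVec] using h

lemma measurable_normSqVec {M : ℕ} : Measurable (normSqVec (M := M)) := by
  unfold normSqVec; fun_prop

lemma normSqVec_nonneg {M : ℕ} (h : Fin M → ℂ) : 0 ≤ normSqVec h :=
  Finset.sum_nonneg fun _ _ => by positivity

lemma star_dotProduct_self {M : ℕ} (y : Fin M → ℂ) :
    dotProduct (star y) y = (normSqVec y : ℂ) := by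
  simp [dotProduct, normSqVec, Complex.conj_mul']

/-- A complex-linear map scales Lebesgue measure by the squared modulus of its determinant. -/
lemma integral_comp_mulVec {M : ℕ} {B : Matrix (Fin M) (Fin M) ℂ} (hB : B.det ≠ 0)
    {f : (Fin M → ℂ) → ℝ} (hf : Measurable f) :
    ∫ y, f (B.mulVec y) = (‖B.det‖ ^ 2)⁻¹ * ∫ y, f y := by
  set T : (Fin M → ℂ) →ₗ[ℝ] (Fin M → ℂ) := (Matrix.toLin' B).restrictScalars ℝ with hT
  have hdet : LinearMap.det T = ‖B.det‖ ^ 2 := by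
    rw [hT, LinearMap.det_restrictScalars, LinearMap.det_toLin', Algebra.norm_complex_apply,
      Complex.normSq_eq_norm_sq]
  have hdet0 : LinearMap.det T ≠ 0 := by rw [hdet]; simpa using hB
  have hmap := Measure.map_linearMap_addHaar_eq_smul_addHaar
    (volume : Measure (Fin M → ℂ)) hdet0
  have hTm : Measurable T := (LinearMap.continuous_of_finiteDimensional T).measurable
  have h1 : ∫ y, f (B.mulVec y) = ∫ y, f y ∂(Measure.map T volume) := by
    rw [integral_map hTm.aemeasurable hf.aestronglyMeasurable]
    rfl
  rw [h1, hmap, integral_smul_measure, hdet, ENNReal.toReal_ofReal (abs_nonneg _),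
    abs_of_nonneg (by positivity), smul_eq_mul]

lemma measurable_complexGaussianPDF {M : ℕ} (K : Matrix (Fin M) (Fin M) ℂ) :
    Measurable (complexGaussianPDF K) := by
  unfold complexGaussianPDF Matrix.mulVec dotProduct
  fun_prop

lemma integral_complexGaussianPDF {M : ℕ} {K : Matrix (Fin M) (Fin M) ℂ} (hK : K.PosDef) :
    ∫ y, complexGaussianPDF K y = 1 := by
  open scoped Matrix.Norms.L2Operator MatrixOrder in
  obtain ⟨B, hB⟩ := CStarAlgebra.nonneg_iff_eq_star_mul_self.mp hK.inv.posSemidef.nonneg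
  have hquad : ∀ y, (dotProduct (star y) (Matrix.mulVec K⁻¹ y)).re = normSqVec (B.mulVec y) := by
    intro y
    have : dotProduct (star y) (Matrix.mulVec K⁻¹ y) = (normSqVec (B.mulVec y) : ℂ) := by
      rw [hB, Matrix.star_eq_conjTranspose, ← Matrix.mulVec_mulVec, Matrix.dotProduct_mulVec,
        ← star_dotProduct_self, Matrix.star_mulVec]
    rw [this, Complex.ofReal_re]
  have hdetK : K.det * (‖B.det‖ ^ 2 : ℝ) = 1 := by
    have h1 : K.det * (K⁻¹).det = 1 := by
      rw [← Matrix.det_mul, Matrix.mul_nonsing_inv _ ((Matrix.isUnit_iff_isUnit_det _).1 hK.isUnit),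
        Matrix.det_one]
    rw [← h1, hB, Matrix.star_eq_conjTranspose, Matrix.det_mul, Matrix.det_conjTranspose]
    simp [Complex.conj_mul']
  have hBdet : B.det ≠ 0 := by
    rintro h0
    simp [h0] at hdetK
  have hre : K.det.re * ‖B.det‖ ^ 2 = 1 := by
    have := congrArg Complex.re hdetK
    rwa [Complex.re_mul_ofReal, Complex.one_re] at this
  have hB2 : 0 < ‖B.det‖ ^ 2 := by positivity
  unfold complexGaussianPDF
  simp_rw [hquad]
  rw [integral_div, integral_comp_mulVec hBdet (f := fun y => Real.exp (-normSqVec y))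
    (measurable_normSqVec.neg.exp), integral_exp_neg_normSqVec]
  have : K.det.re ≠ 0 := by rintro h; simp [h] at hre
  have := Real.pi_pos
  field_simp
  linarith

lemma complexGaussianPDF_nonneg {M : ℕ} {K : Matrix (Fin M) (Fin M) ℂ} (hK : K.PosDef)
    (y : Fin M → ℂ) : 0 ≤ complexGaussianPDF K y := by
  have := (Complex.lt_def.1 hK.det_pos).1
  have h0 : 0 < K.det.re := by simpa using this
  unfold complexGaussianPDF
  positivity

lemma integrable_complexGaussianPDF {M : ℕ} {K : Matrix (Fin M) (Fin M) ℂ} (hK : K.PosDef) :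
    Integrable (complexGaussianPDF K) :=
  .of_integral_ne_zero (by rw [integral_complexGaussianPDF hK]; exact one_ne_zero)

lemma isProbabilityMeasure_complexGaussian {M : ℕ} {K : Matrix (Fin M) (Fin M) ℂ}
    (hK : K.PosDef) : IsProbabilityMeasure (complexGaussian K) := by
  refine ⟨?_⟩
  rw [complexGaussian, withDensity_apply _ MeasurableSet.univ, Measure.restrict_univ,
    ← ofReal_integral_eq_lintegral_ofReal (integrable_complexGaussianPDF hK)
      (.of_forall (complexGaussianPDF_nonneg hK)), integral_complexGaussianPDF hK,
    ENNReal.ofReal_one]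

/-! ### Kullback-Leibler divergence of independent copies -/

/-- A product of laws with log-densities `f` has the log-density `∑ i, f (y i)`. -/
lemma pi_withDensity_ofReal_exp {X : Type*} [MeasurableSpace X] {ι : Type*} [Fintype ι]
    {ν : Measure X} [IsProbabilityMeasure ν] {f : X → ℝ} (hf : Measurable f)
    [IsProbabilityMeasure (ν.withDensity fun x => ENNReal.ofReal (Real.exp (f x)))] :
    (Measure.pi fun _ : ι => ν.withDensity fun x => ENNReal.ofReal (Real.exp (f x)))
      = (Measure.pi fun _ : ι => ν).withDensity
          fun y => ENNReal.ofReal (Real.exp (∑ i, f (y i))) := by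
  refine Measure.pi_eq fun s hs => ?_
  have hind := iIndepFun_pi (μ := fun _ : ι => ν)
    (X := fun i x => (s i).indicator (fun x => ENNReal.ofReal (Real.exp (f x))) x)
    (fun i => (Measurable.indicator (by fun_prop) (hs i)).aemeasurable)
  have hprod := lintegral_prod_eq_prod_lintegral_of_indepFun Finset.univ _ hind
    (fun i => ((Measurable.indicator (by fun_prop) (hs i)).comp (measurable_pi_apply i)))
  rw [withDensity_apply _ (MeasurableSet.univ_pi hs), ← lintegral_indicator
    (MeasurableSet.univ_pi hs)]
  have h1 : ∀ y : ι → X, (univ.pi s).indicator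
      (fun y => ENNReal.ofReal (Real.exp (∑ i, f (y i)))) y
      = ∏ i, (s i).indicator (fun x => ENNReal.ofReal (Real.exp (f x))) (y i) := by
    intro y
    by_cases hy : y ∈ univ.pi s
    · rw [indicator_of_mem hy, Real.exp_sum,
        ENNReal.ofReal_prod_of_nonneg fun _ _ => (Real.exp_pos _).le]
      exact Finset.prod_congr rfl fun i _ => 
        (indicator_of_mem (hy i (mem_univ i)) (fun x => ENNReal.ofReal (Real.exp (f x)))).symm
    · rw [indicator_of_notMem hy]
      simp only [Set.mem_pi, mem_univ, true_imp_iff, not_forall] at hy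
      obtain ⟨i, hi⟩ := hy
      exact (Finset.prod_eq_zero (Finset.mem_univ i) (indicator_of_notMem hi _)).symm
  simp_rw [h1]
  rw [hprod]
  refine Finset.prod_congr rfl fun i _ => ?_
  rw [withDensity_apply _ (hs i), ← lintegral_indicator (hs i)]
  exact (measurePreserving_eval (fun _ : ι => ν) i).lintegral_comp
    (Measurable.indicator (by fun_prop) (hs i))

/-- Additivity of the Kullback-Leibler divergence over independent copies, for laws with an
explicit log-likelihood ratio `f`. -/
lemma klDiv_pi_eq {X : Type*} [MeasurableSpace X] {μ ν : Measure X}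
    [IsProbabilityMeasure μ] [IsProbabilityMeasure ν] {f : X → ℝ} (hf : Measurable f)
    (hμ : μ = ν.withDensity fun x => ENNReal.ofReal (Real.exp (f x))) (hint : Integrable f μ)
    (n : ℕ) :
    InformationTheory.klDiv (Measure.pi fun _ : Fin n => μ) (Measure.pi fun _ : Fin n => ν)
      = ENNReal.ofReal (n * ∫ x, f x ∂μ) := by
  have hpi : (Measure.pi fun _ : Fin n => μ) = (Measure.pi fun _ : Fin n => ν).withDensity
      fun y => ENNReal.ofReal (Real.exp (∑ i, f (y i))) := by
    have : IsProbabilityMeasure (ν.withDensity fun x => ENNReal.ofReal (Real.exp (f x))) := by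
      rw [← hμ]; infer_instance
    rw [hμ]
    exact pi_withDensity_ofReal_exp hf
  have hac : (Measure.pi fun _ : Fin n => μ) ≪ (Measure.pi fun _ : Fin n => ν) := by
    rw [hpi]; exact withDensity_absolutelyContinuous _ _
  have hllr : llr (Measure.pi fun _ : Fin n => μ) (Measure.pi fun _ : Fin n => ν)
      =ᵐ[Measure.pi fun _ : Fin n => μ] fun y => ∑ i, f (y i) := by
    have hrn := Measure.rnDeriv_withDensity (Measure.pi fun _ : Fin n => ν)
      (f := fun y => ENNReal.ofReal (Real.exp (∑ i, f (y i)))) (by fun_prop)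
    rw [← hpi] at hrn
    filter_upwards [hac.ae_le hrn] with y hy
    rw [llr, hy, ENNReal.toReal_ofReal (Real.exp_pos _).le, Real.log_exp]
  have hi : ∀ i : Fin n, Integrable (fun y : Fin n → X => f (y i)) (Measure.pi fun _ => μ) :=
    fun i => integrable_comp_eval (μ := fun _ : Fin n => μ) hint
  have hsum : Integrable (fun y : Fin n → X => ∑ i, f (y i)) (Measure.pi fun _ => μ) :=
    integrable_finsetSum _ fun i _ => hi i
  rw [InformationTheory.klDiv_of_ac_of_integrable hac ((integrable_congr hllr).2 hsum),
    integral_congr_ae hllr, integral_finsetSum _ fun i _ => hi i]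
  simp_rw [integral_comp_eval (μ := fun _ : Fin n => μ) hint.aestronglyMeasurable]
  simp

/-! ### Second moments of the standard complex Gaussian law -/

lemma integral_mul_exp_neg_norm_sq : ∫ z : ℂ, z * (Real.exp (-‖z‖ ^ 2) : ℂ) = 0 := by
  have h := integral_neg_eq_self (fun z : ℂ => z * (Real.exp (-‖z‖ ^ 2) : ℂ)) volume
  simp only [norm_neg, neg_mul, integral_neg] at h
  exact self_eq_neg.1 h.symm

lemma integrable_norm_mul_exp_neg_norm_sq :
    Integrable fun z : ℂ => ‖z‖ * Real.exp (-‖z‖ ^ 2) := by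
  refine (integrable_exp_neg_norm_sq.add integrable_norm_sq_mul_exp_neg_norm_sq).mono'
    (by fun_prop) (.of_forall fun z => ?_)
  rw [Real.norm_of_nonneg (by positivity)]
  have := Real.exp_pos (-‖z‖ ^ 2)
  simp only [Pi.add_apply]
  nlinarith [sq_nonneg (‖z‖ - 1), sq_nonneg ‖z‖]

/-- The factor at coordinate `k` of `y i * conj (y j) * exp (-‖y‖²)`. -/
noncomputable def momentFactor {M : ℕ} (i j k : Fin M) (z : ℂ) : ℂ :=
  (if k = i then z else 1) * (if k = j then (starRingEnd ℂ) z else 1) * (Real.exp (-‖z‖ ^ 2) : ℂ)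

lemma prod_momentFactor {M : ℕ} (i j : Fin M) (y : Fin M → ℂ) :
    ∏ k, momentFactor i j k (y k)
      = y i * (starRingEnd ℂ) (y j) * (Real.exp (-normSqVec y) : ℂ) := by
  simp only [momentFactor, Finset.prod_mul_distrib, Finset.prod_ite_eq', Finset.mem_univ, if_true,
    normSqVec]
  rw [← Finset.sum_neg_distrib, Real.exp_sum]
  push_cast
  rfl

lemma integrable_momentFactor {M : ℕ} (i j k : Fin M) : Integrable (momentFactor i j k) := by
  have hm : Measurable (momentFactor i j k) := by
    unfold momentFactor
    have : Measurable (starRingEnd ℂ) := Complex.continuous_conj.measurable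
    split_ifs <;> fun_prop
  refine (integrable_exp_neg_norm_sq.add (integrable_norm_mul_exp_neg_norm_sq.add
    integrable_norm_sq_mul_exp_neg_norm_sq)).mono' hm.aestronglyMeasurable (.of_forall fun z => ?_)
  have h0 := Real.exp_pos (-‖z‖ ^ 2)
  have h1 := norm_nonneg z
  have h2 : 0 ≤ ‖z‖ * Real.exp (-‖z‖ ^ 2) := by positivity
  have h3 : 0 ≤ ‖z‖ ^ 2 * Real.exp (-‖z‖ ^ 2) := by positivity
  have e : ‖((Real.exp (-‖z‖ ^ 2) : ℝ) : ℂ)‖ = Real.exp (-‖z‖ ^ 2) := by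
    rw [Complex.norm_real, Real.norm_of_nonneg h0.le]
  simp only [momentFactor, Pi.add_apply]
  split_ifs <;> rw [norm_mul, norm_mul, e] <;> simp <;> nlinarith

lemma integral_momentFactor_self {M : ℕ} (i k : Fin M) :
    ∫ z, momentFactor i i k z = Real.pi := by
  by_cases h : k = i
  · have : ∀ z, momentFactor i i k z = ((‖z‖ ^ 2 * Real.exp (-‖z‖ ^ 2) : ℝ) : ℂ) := by
      intro z
      simp [momentFactor, h, Complex.mul_conj']
    simp_rw [this]
    rw [integral_complex_ofReal, integral_norm_sq_mul_exp_neg_norm_sq]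
  · have : ∀ z, momentFactor i i k z = ((Real.exp (-‖z‖ ^ 2) : ℝ) : ℂ) := by
      intro z
      simp [momentFactor, h]
    simp_rw [this]
    rw [integral_complex_ofReal, integral_exp_neg_norm_sq]

lemma integral_momentFactor_of_ne {M : ℕ} {i j : Fin M} (hij : i ≠ j) :
    ∫ z, momentFactor i j i z = 0 := by
  simpa [momentFactor, hij] using integral_mul_exp_neg_norm_sq

lemma integrable_mul_conj_mul_exp {M : ℕ} (i j : Fin M) :
    Integrable fun y : Fin M → ℂ =>
      y i * (starRingEnd ℂ) (y j) * (Real.exp (-normSqVec y) : ℂ) := by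
  simp_rw [← prod_momentFactor]
  exact Integrable.fintype_prod_dep (fun k => integrable_momentFactor i j k)

lemma integral_mul_conj_mul_exp {M : ℕ} (i j : Fin M) :
    ∫ y : Fin M → ℂ, y i * (starRingEnd ℂ) (y j) * (Real.exp (-normSqVec y) : ℂ)
      = if i = j then (Real.pi : ℂ) ^ M else 0 := by
  simp_rw [← prod_momentFactor]
  rw [integral_fintype_prod_volume_eq_prod (fun k z => momentFactor i j k z)]
  split_ifs with h
  · subst h
    simp [integral_momentFactor_self]
  · exact Finset.prod_eq_zero (Finset.mem_univ i) (integral_momentFactor_of_ne h)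

lemma norm_sq_dotProduct_star {M : ℕ} (h y : Fin M → ℂ) :
    ((‖dotProduct (star h) y‖ ^ 2 : ℝ) : ℂ)
      = ∑ i, ∑ j, (starRingEnd ℂ) (h i) * h j * (y i * (starRingEnd ℂ) (y j)) := by
  rw [Complex.ofReal_pow, ← Complex.mul_conj']
  simp only [dotProduct, map_sum, Finset.sum_mul_sum, map_mul, Pi.star_apply, RCLike.star_def,
    Complex.conj_conj]
  refine Finset.sum_congr rfl fun i _ => Finset.sum_congr rfl fun j _ => by ring

lemma norm_sq_dotProduct_mul_exp {M : ℕ} (h y : Fin M → ℂ) :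
    ((‖dotProduct (star h) y‖ ^ 2 * Real.exp (-normSqVec y) : ℝ) : ℂ)
      = ∑ i, ∑ j, (starRingEnd ℂ) (h i) * h j *
          (y i * (starRingEnd ℂ) (y j) * (Real.exp (-normSqVec y) : ℂ)) := by
  rw [Complex.ofReal_mul, norm_sq_dotProduct_star, Finset.sum_mul]
  refine Finset.sum_congr rfl fun i _ => ?_
  rw [Finset.sum_mul]
  exact Finset.sum_congr rfl fun j _ => by ring

lemma integrable_norm_sq_dotProduct_mul_exp {M : ℕ} (h : Fin M → ℂ) :
    Integrable fun y : Fin M → ℂ =>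
      ‖dotProduct (star h) y‖ ^ 2 * Real.exp (-normSqVec y) := by
  have hc : Integrable fun y : Fin M → ℂ =>
      ((‖dotProduct (star h) y‖ ^ 2 * Real.exp (-normSqVec y) : ℝ) : ℂ) := by
    simp_rw [norm_sq_dotProduct_mul_exp]
    exact integrable_finsetSum _ fun i _ => integrable_finsetSum _ fun j _ =>
      (integrable_mul_conj_mul_exp i j).const_mul _
  exact hc.re

lemma integral_norm_sq_dotProduct_mul_exp {M : ℕ} (h : Fin M → ℂ) :
    ∫ y : Fin M → ℂ, ‖dotProduct (star h) y‖ ^ 2 * Real.exp (-normSqVec y)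
      = Real.pi ^ M * normSqVec h := by
  have hc : (∫ y : Fin M → ℂ,
      ((‖dotProduct (star h) y‖ ^ 2 * Real.exp (-normSqVec y) : ℝ) : ℂ))
        = ((Real.pi ^ M * normSqVec h : ℝ) : ℂ) := by
    simp_rw [norm_sq_dotProduct_mul_exp]
    rw [integral_finsetSum _ fun i _ => integrable_finsetSum _ fun j _ =>
      (integrable_mul_conj_mul_exp i j).const_mul _]
    simp_rw [fun i : Fin M => integral_finsetSum Finset.univ fun j _ =>
      (integrable_mul_conj_mul_exp i j).const_mul ((starRingEnd ℂ) (h i) * h j),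
      integral_const_mul, integral_mul_conj_mul_exp]
    simp [normSqVec, Complex.mul_conj', Finset.mul_sum, mul_comm]
  rw [integral_complex_ofReal] at hc
  exact_mod_cast hc

/-! ### Divergence between the silent and the transmitting law -/

lemma posDef_covTransmit {M : ℕ} {P : ℝ} (hP : 0 < P) (h : Fin M → ℂ) :
    (covTransmit P h).PosDef := by
  unfold covTransmit
  refine Matrix.PosDef.posSemidef_add ?_ Matrix.PosDef.one
  exact (Matrix.posSemidef_vecMulVec_self_star h).smul (by simpa using hP.le)

lemma det_covTransmit {M : ℕ} (P : ℝ) (h : Fin M → ℂ) :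
    (covTransmit P h).det = ((1 + P * normSqVec h : ℝ) : ℂ) := by
  have e : covTransmit P h = 1 + Matrix.replicateCol Unit ((P : ℂ) • h)
      * Matrix.replicateRow Unit (star h) := by
    rw [covTransmit, ← Matrix.vecMulVec_eq, Matrix.smul_vecMulVec, add_comm]
  rw [e, Matrix.det_one_add_replicateCol_mul_replicateRow, dotProduct_smul, star_dotProduct_self]
  simp

/-- The Sherman-Morrison formula for the covariance matrix `P h hᴴ + I`. -/
lemma inv_covTransmit {M : ℕ} {P : ℝ} (hP : 0 < P) (h : Fin M → ℂ) :
    (covTransmit P h)⁻¹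
      = 1 - ((P / (1 + P * normSqVec h) : ℝ) : ℂ) • Matrix.vecMulVec h (star h) := by
  have hx : 0 ≤ P * normSqVec h := mul_nonneg hP.le (normSqVec_nonneg h)
  have hx' : (1 + P * normSqVec h : ℂ) ≠ 0 := by
    have : (1 + P * normSqVec h : ℝ) ≠ 0 := by positivity
    exact_mod_cast this
  refine Matrix.inv_eq_right_inv ?_
  have hsq : Matrix.vecMulVec h (star h) * Matrix.vecMulVec h (star h)
      = (normSqVec h : ℂ) • Matrix.vecMulVec h (star h) := by
    rw [Matrix.vecMulVec_mul_vecMulVec, star_dotProduct_self]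
    ext i j
    simp [Matrix.vecMulVec_apply]
    ring
  rw [covTransmit, add_mul, mul_sub, mul_sub, smul_mul_smul_comm, hsq]
  simp only [mul_one, one_mul, smul_smul]
  have : ((P : ℂ) * ((P / (1 + P * normSqVec h) : ℝ) : ℂ) * normSqVec h)
      = P - ((P / (1 + P * normSqVec h) : ℝ) : ℂ) := by
    push_cast
    field_simp
    ring
  rw [this, sub_smul]
  abel

/-- The log-likelihood ratio of one observation, silent against transmitting. -/
noncomputable def logRatio {M : ℕ} (P : ℝ) (h y : Fin M → ℂ) : ℝ :=
  Real.log (1 + P * normSqVec h)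
    - P / (1 + P * normSqVec h) * ‖dotProduct (star h) y‖ ^ 2

lemma complexGaussianPDF_one {M : ℕ} (y : Fin M → ℂ) :
    complexGaussianPDF 1 y = Real.exp (-normSqVec y) / Real.pi ^ M := by
  simp [complexGaussianPDF, star_dotProduct_self]

lemma complexGaussianPDF_covTransmit {M : ℕ} {P : ℝ} (hP : 0 < P) (h y : Fin M → ℂ) :
    complexGaussianPDF (covTransmit P h) y =
      Real.exp (-(normSqVec y - P / (1 + P * normSqVec h) * ‖dotProduct (star h) y‖ ^ 2))
        / (Real.pi ^ M * (1 + P * normSqVec h)) := by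
  have hquad : dotProduct (star y) (Matrix.mulVec (covTransmit P h)⁻¹ y)
      = ((normSqVec y - P / (1 + P * normSqVec h) * ‖dotProduct (star h) y‖ ^ 2 : ℝ) : ℂ) := by
    rw [inv_covTransmit hP, Matrix.sub_mulVec, Matrix.one_mulVec, dotProduct_sub,
      star_dotProduct_self, Matrix.smul_mulVec, Matrix.vecMulVec_mulVec, dotProduct_smul]
    have : dotProduct (star y) h = star (dotProduct (star h) y) :=
      Matrix.star_dotProduct y h
    simp only [op_smul_eq_smul, dotProduct_smul, this, smul_eq_mul]
    rw [RCLike.star_def, Complex.mul_conj']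
    push_cast
    rfl
  rw [complexGaussianPDF, hquad, det_covTransmit, Complex.ofReal_re, Complex.ofReal_re]

lemma complexGaussianPDF_mul_exp_logRatio {M : ℕ} {P : ℝ} (hP : 0 < P) (h y : Fin M → ℂ) :
    complexGaussianPDF (covTransmit P h) y * Real.exp (logRatio P h y)
      = complexGaussianPDF 1 y := by
  have hx : 0 < 1 + P * normSqVec h := by
    have := mul_nonneg hP.le (normSqVec_nonneg h); positivity
  rw [complexGaussianPDF_covTransmit hP, complexGaussianPDF_one, logRatio, neg_sub, Real.exp_sub,
    Real.exp_sub, Real.exp_log hx, Real.exp_neg]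
  have := Real.pi_pos
  field_simp

lemma measurable_logRatio {M : ℕ} (P : ℝ) (h : Fin M → ℂ) : Measurable (logRatio P h) := by
  unfold logRatio dotProduct; fun_prop

lemma complexGaussian_one_eq_withDensity {M : ℕ} {P : ℝ} (hP : 0 < P) (h : Fin M → ℂ) :
    complexGaussian (1 : Matrix (Fin M) (Fin M) ℂ) = (complexGaussian (covTransmit P h)).withDensity
      fun y => ENNReal.ofReal (Real.exp (logRatio P h y)) := by
  rw [complexGaussian, complexGaussian, ← withDensity_mul]
  · congr 1
    ext y
    rw [Pi.mul_apply, ← ENNReal.ofReal_mul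
      (complexGaussianPDF_nonneg (posDef_covTransmit hP h) y),
      complexGaussianPDF_mul_exp_logRatio hP]
  · exact (measurable_complexGaussianPDF _).ennreal_ofReal
  · exact (measurable_logRatio P h).exp.ennreal_ofReal

lemma integrable_complexGaussian_iff {M : ℕ} {K : Matrix (Fin M) (Fin M) ℂ} (hK : K.PosDef)
    {f : (Fin M → ℂ) → ℝ} :
    Integrable f (complexGaussian K) ↔ Integrable fun y => complexGaussianPDF K y * f y := by
  rw [complexGaussian, integrable_withDensity_iff_integrable_smul'
    (measurable_complexGaussianPDF K).ennreal_ofReal (.of_forall fun _ => ENNReal.ofReal_lt_top)]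
  simp_rw [ENNReal.toReal_ofReal (complexGaussianPDF_nonneg hK _), smul_eq_mul]

lemma integral_complexGaussian {M : ℕ} {K : Matrix (Fin M) (Fin M) ℂ} (hK : K.PosDef)
    (f : (Fin M → ℂ) → ℝ) :
    ∫ y, f y ∂complexGaussian K = ∫ y, complexGaussianPDF K y * f y := by
  rw [complexGaussian, integral_withDensity_eq_integral_toReal_smul
    (measurable_complexGaussianPDF K).ennreal_ofReal (.of_forall fun _ => ENNReal.ofReal_lt_top)]
  simp_rw [ENNReal.toReal_ofReal (complexGaussianPDF_nonneg hK _), smul_eq_mul]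

lemma integrable_norm_sq_dotProduct {M : ℕ} (h : Fin M → ℂ) :
    Integrable (fun y => ‖dotProduct (star h) y‖ ^ 2)
      (complexGaussian (1 : Matrix (Fin M) (Fin M) ℂ)) := by
  rw [integrable_complexGaussian_iff Matrix.PosDef.one]
  refine ((integrable_norm_sq_dotProduct_mul_exp h).div_const (Real.pi ^ M)).congr
    (.of_forall fun y => ?_)
  simp only [complexGaussianPDF_one]
  ring

lemma integral_norm_sq_dotProduct {M : ℕ} (h : Fin M → ℂ) :
    ∫ y, ‖dotProduct (star h) y‖ ^ 2 ∂complexGaussian (1 : Matrix (Fin M) (Fin M) ℂ)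
      = normSqVec h := by
  have e : ∀ y : Fin M → ℂ, complexGaussianPDF 1 y * ‖dotProduct (star h) y‖ ^ 2
      = ‖dotProduct (star h) y‖ ^ 2 * Real.exp (-normSqVec y) / Real.pi ^ M := by
    intro y
    rw [complexGaussianPDF_one]
    ring
  rw [integral_complexGaussian Matrix.PosDef.one]
  simp_rw [e]
  rw [integral_div, integral_norm_sq_dotProduct_mul_exp]
  have := Real.pi_pos
  field_simp

/-- The divergence per observation as a function of the received power `x = P ‖h‖²`. -/
noncomputable def divergence (x : ℝ) : ℝ := Real.log (1 + x) - x / (1 + x)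

lemma klDiv_lawSilent_lawTransmit {M : ℕ} (n : ℕ) {P : ℝ} (hP : 0 < P) (h : Fin M → ℂ) :
    InformationTheory.klDiv (lawSilent M n) (lawTransmit n P h)
      = ENNReal.ofReal (n * divergence (P * normSqVec h)) := by
  have := isProbabilityMeasure_complexGaussian (Matrix.PosDef.one (n := Fin M) (R := ℂ))
  have := isProbabilityMeasure_complexGaussian (posDef_covTransmit hP h)
  have hi := (integrable_norm_sq_dotProduct h).const_mul (P / (1 + P * normSqVec h))
  have hint : Integrable (logRatio P h) (complexGaussian 1) := (integrable_const _).sub hi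
  rw [lawSilent, lawTransmit, klDiv_pi_eq (measurable_logRatio P h)
    (complexGaussian_one_eq_withDensity hP h) hint]
  congr 2
  unfold logRatio
  rw [integral_sub (integrable_const _) hi, integral_const_mul, integral_norm_sq_dotProduct,
    divergence]
  simp
  ring

/-! ### The Erlang distribution -/

lemma gammaPDFReal_natCast_add_one (k : ℕ) (r : ℝ) {x : ℝ} (hx : 0 ≤ x) :
    gammaPDFReal ((k + 1 : ℕ) : ℝ) r x
      = r ^ (k + 1) / (k.factorial : ℝ) * (x ^ k * Real.exp (-(r * x))) := by
  rw [gammaPDFReal, if_pos hx, Real.rpow_natCast]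
  push_cast
  rw [Real.Gamma_nat_eq_factorial, add_sub_cancel_right, Real.rpow_natCast]
  ring

lemma gammaMeasure_eq_restrict {a r : ℝ} : gammaMeasure a r
    = (volume.restrict (Ioi 0)).withDensity (gammaPDF a r) := by
  rw [gammaMeasure, ← withDensity_indicator measurableSet_Ioi]
  refine withDensity_congr_ae ?_
  have : ∀ᵐ x : ℝ, x ≠ 0 := by simp [ae_iff]
  filter_upwards [this] with x hx
  rcases lt_or_gt_of_ne hx with h | h
  · rw [gammaPDF_of_neg h, indicator_of_notMem (by simpa using h.le)]
  · rw [indicator_of_mem (by simpa using h)]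

lemma measurable_gammaPDF (a r : ℝ) : Measurable (gammaPDF a r) :=
  (measurable_gammaPDFReal a r).ennreal_ofReal

lemma integral_gammaMeasure {E : Type*} [NormedAddCommGroup E] [NormedSpace ℝ E]
    (k : ℕ) {r : ℝ} (hr : 0 < r) (f : ℝ → E) :
    ∫ x, f x ∂gammaMeasure ((k + 1 : ℕ) : ℝ) r
      = ∫ x in Ioi 0, (r ^ (k + 1) / (k.factorial : ℝ) * (x ^ k * Real.exp (-(r * x)))) • f x := by
  rw [gammaMeasure_eq_restrict, integral_withDensity_eq_integral_toReal_smul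
    (measurable_gammaPDF _ _) (.of_forall fun _ => ENNReal.ofReal_lt_top)]
  refine setIntegral_congr_fun measurableSet_Ioi fun x hx => ?_
  simp only [gammaPDF]
  rw [ENNReal.toReal_ofReal (gammaPDFReal_nonneg (by positivity) hr x),
    gammaPDFReal_natCast_add_one k r (le_of_lt hx)]

lemma integrable_gammaMeasure_iff {E : Type*} [NormedAddCommGroup E] [NormedSpace ℝ E]
    (k : ℕ) {r : ℝ} (hr : 0 < r) {f : ℝ → E} :
    Integrable f (gammaMeasure ((k + 1 : ℕ) : ℝ) r)
      ↔ IntegrableOn (fun x => (x ^ k * Real.exp (-(r * x))) • f x) (Ioi 0) := by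
  rw [gammaMeasure_eq_restrict, integrable_withDensity_iff_integrable_smul'
    (measurable_gammaPDF _ _) (.of_forall fun _ => ENNReal.ofReal_lt_top)]
  have hc : r ^ (k + 1) / (k.factorial : ℝ) ≠ 0 := by positivity
  rw [IntegrableOn, ← integrable_smul_iff hc
    (fun x : ℝ => (x ^ k * Real.exp (-(r * x))) • f x)]
  refine integrable_congr ((ae_restrict_iff' measurableSet_Ioi).2 (.of_forall fun x hx => ?_))
  simp only [gammaPDF, Pi.smul_apply]
  rw [ENNReal.toReal_ofReal (gammaPDFReal_nonneg (by positivity) hr x),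
    gammaPDFReal_natCast_add_one k r (le_of_lt hx), smul_smul]

lemma integrableOn_pow_mul_exp_neg_mul (k : ℕ) {r : ℝ} (hr : 0 < r) :
    IntegrableOn (fun x : ℝ => x ^ k * Real.exp (-(r * x))) (Ioi 0) := by
  have h := integrableOn_rpow_mul_exp_neg_mul_rpow (p := 1) (s := k) (b := r)
    (by linarith [Nat.cast_nonneg (α := ℝ) k]) one_pos hr
  simpa using h

lemma norm_pow_mul_cexp (k : ℕ) (z : ℂ) {x : ℝ} (hx : 0 ≤ x) :
    ‖(x : ℂ) ^ k * Complex.exp (-(z * x))‖ = x ^ k * Real.exp (-(z.re * x)) := by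
  rw [norm_mul, norm_pow, Complex.norm_real, Real.norm_of_nonneg hx, Complex.norm_exp]
  simp

lemma integrableOn_pow_mul_cexp (k : ℕ) {z : ℂ} (hz : 0 < z.re) :
    IntegrableOn (fun x : ℝ => (x : ℂ) ^ k * Complex.exp (-(z * x))) (Ioi 0) := by
  refine (integrableOn_pow_mul_exp_neg_mul k hz).mono' (by fun_prop) ?_
  filter_upwards [self_mem_ae_restrict measurableSet_Ioi] with x hx
  exact (norm_pow_mul_cexp k z (le_of_lt hx)).le

lemma tendsto_pow_mul_cexp_atTop (k : ℕ) {z : ℂ} (hz : 0 < z.re) :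
    Tendsto (fun x : ℝ => (x : ℂ) ^ k * Complex.exp (-(z * x))) atTop (𝓝 0) := by
  refine tendsto_zero_iff_norm_tendsto_zero.2 ?_
  have h := tendsto_rpow_mul_exp_neg_mul_atTop_nhds_zero k z.re hz
  refine h.congr' ?_
  filter_upwards [eventually_ge_atTop 0] with x hx
  rw [norm_pow_mul_cexp k z hx, Real.rpow_natCast, neg_mul]

/-- Euler's integral `∫ x ^ k * exp (-z x) = k! / z ^ (k + 1)` for complex `z`, by repeated
integration by parts. -/
lemma integral_pow_mul_cexp (k : ℕ) {z : ℂ} (hz : 0 < z.re) :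
    ∫ x : ℝ in Ioi 0, (x : ℂ) ^ k * Complex.exp (-(z * x)) = k.factorial / z ^ (k + 1) := by
  have hz0 : z ≠ 0 := by rintro rfl; simp at hz
  have hexp : ∀ x : ℝ, HasDerivAt (fun x : ℝ => Complex.exp (-(z * x)))
      (Complex.exp (-(z * x)) * -(z * 1)) x := fun x =>
    ((Complex.ofRealCLM.hasDerivAt (x := x)).const_mul z).neg.cexp
  induction k with
  | zero =>
    have h := integral_Ioi_of_hasDerivAt_of_tendsto' (a := 0)
      (f := fun x : ℝ => Complex.exp (-(z * x)) * (-(1 / z))) (m := 0 * (-(1 / z)))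
      (fun x _ => (hexp x).mul_const (-(1 / z)))
      (by
        have := integrableOn_pow_mul_cexp 0 hz
        refine this.congr_fun (fun x _ => ?_) measurableSet_Ioi
        simp only [pow_zero, one_mul]
        field_simp)
      (((tendsto_pow_mul_cexp_atTop 0 hz).congr fun x => by simp).mul_const _)
    simp only [pow_zero, one_mul, Nat.factorial_zero, Nat.cast_one, zero_add, pow_one]
    have e : ∀ x : ℝ, Complex.exp (-(z * x)) = Complex.exp (-(z * x)) * -(z * 1) * (-(1 / z)) := by
      intro x
      field_simp
    rw [integral_congr_ae (.of_forall e), h]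
    simp
  | succ k ih =>
    have hd : ∀ x : ℝ, HasDerivAt (fun x : ℝ => (x : ℂ) ^ (k + 1) * Complex.exp (-(z * x)))
        (((k + 1 : ℕ) : ℂ) * ((x : ℂ) ^ k * Complex.exp (-(z * x)))
          - z * ((x : ℂ) ^ (k + 1) * Complex.exp (-(z * x)))) x := by
      intro x
      have h1 := ((Complex.ofRealCLM.hasDerivAt (x := x)).pow (k + 1)).mul (hexp x)
      refine h1.congr_deriv ?_
      simp
      ring
    have hi1 := (integrableOn_pow_mul_cexp k hz).const_mul ((k + 1 : ℕ) : ℂ)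
    have hi2 := (integrableOn_pow_mul_cexp (k + 1) hz).const_mul z
    have h := integral_Ioi_of_hasDerivAt_of_tendsto' (a := 0) (fun x _ => hd x) (hi1.sub hi2)
      (tendsto_pow_mul_cexp_atTop (k + 1) hz)
    rw [integral_sub hi1 hi2, integral_const_mul, integral_const_mul, ih] at h
    simp only [Complex.ofReal_zero, ne_eq, Nat.add_eq_zero_iff, one_ne_zero, and_false,
      not_false_eq_true, zero_pow, zero_mul, sub_zero] at h
    rw [sub_eq_zero] at h
    rw [eq_div_iff (pow_ne_zero _ hz0), pow_succ, mul_comm _ z, ← mul_assoc, mul_comm _ z, ← h,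
      Nat.factorial_succ]
    push_cast
    field_simp

lemma charFun_gammaMeasure (k : ℕ) {r : ℝ} (hr : 0 < r) (t : ℝ) :
    charFun (gammaMeasure ((k + 1 : ℕ) : ℝ) r) t
      = ((r : ℂ) / (r - t * Complex.I)) ^ (k + 1) := by
  have hre : 0 < ((r : ℂ) - t * Complex.I).re := by simpa using hr
  rw [charFun_apply_real, integral_gammaMeasure k hr]
  have e : ∀ x : ℝ, (r ^ (k + 1) / (k.factorial : ℝ) * (x ^ k * Real.exp (-(r * x))))
        • Complex.exp (t * x * Complex.I)
      = ((r : ℂ) ^ (k + 1) / k.factorial)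
        * ((x : ℂ) ^ k * Complex.exp (-((r - t * Complex.I) * x))) := by
    intro x
    have : Complex.exp (-((r - t * Complex.I) * x))
        = Complex.exp (-(r * x)) * Complex.exp (t * x * Complex.I) := by
      rw [← Complex.exp_add]; congr 1; ring
    rw [this, Complex.real_smul]
    push_cast
    ring
  simp_rw [e]
  rw [integral_const_mul, integral_pow_mul_cexp k hre, div_pow]
  have : (k.factorial : ℂ) ≠ 0 := by exact_mod_cast k.factorial_ne_zero
  field_simp

/-- The sum of `k + 1` independent exponential variables has the Erlang distribution. -/
lemma hasLaw_sum_gammaMeasure {Ω : Type*} [MeasurableSpace Ω] {μ : Measure Ω}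
    [IsProbabilityMeasure μ] {k : ℕ} {r : ℝ} (hr : 0 < r) {X : Fin (k + 1) → Ω → ℝ}
    (hind : iIndepFun X μ) (hX : ∀ i, HasLaw (X i) (expMeasure r) μ) :
    HasLaw (fun ω => ∑ i, X i ω) (gammaMeasure ((k + 1 : ℕ) : ℝ) r) μ := by
  have hm : ∀ i, AEMeasurable (X i) μ := fun i => (hX i).aemeasurable
  have hms : AEMeasurable (fun ω => ∑ i, X i ω) μ := by fun_prop
  have := isProbabilityMeasure_gammaMeasure (a := ((k + 1 : ℕ) : ℝ)) (by positivity) hr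
  have := Measure.isProbabilityMeasure_map hms
  refine ⟨hms, Measure.ext_of_charFun (funext fun t => ?_)⟩
  rw [hind.charFun_map_fun_sum_eq_prod hm, charFun_gammaMeasure k hr, Finset.prod_apply]
  have h1 : ∀ i, charFun (μ.map (X i)) t = (r : ℂ) / (r - t * Complex.I) := by
    intro i
    rw [(hX i).map_eq, expMeasure]
    simpa using charFun_gammaMeasure 0 hr t
  simp [h1, div_pow]

/-! ### Incomplete Gamma, beta and Mellin integrals -/

/-- Euler's integral for the upper incomplete Gamma function at `-(k + 1)`. -/
lemma integral_erlang_div (k : ℕ) {lam P : ℝ} (hlam : 0 < lam) (hP : 0 < P) :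
    ∫ x in Ioi 0, x ^ k * Real.exp (-(lam * x)) * (P * x / (1 + P * x))
      = 1 / P ^ (k + 1) * Real.Gamma (((k + 1 : ℕ) : ℝ) + 1) * Real.exp (lam / P)
        * upperGamma (-((k + 1 : ℕ) : ℝ)) (lam / P) := by
  set z := lam / P with hz
  have hz0 : 0 < z := div_pos hlam hP
  have hlamz : lam = z * P := by rw [hz]; field_simp
  set F : ℝ → ℝ → ℝ := fun u t => u ^ (k + 1) * Real.exp (-((1 + u) * t)) with hF
  have hinner : ∀ u ∈ Ioi (0 : ℝ),
      ∫ t in Ioi z, F u t = u ^ (k + 1) * Real.exp (-(z * u)) / (1 + u) * Real.exp (-z) := by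
    intro u hu
    have hu' : 0 < 1 + u := by have := mem_Ioi.1 hu; linarith
    simp only [hF]
    have h := integral_exp_mul_Ioi (a := -(1 + u)) (by linarith) z
    rw [integral_const_mul]
    simp only [neg_mul] at h
    rw [h]
    have : Real.exp (-((1 + u) * z)) = Real.exp (-(z * u)) * Real.exp (-z) := by
      rw [← Real.exp_add]; congr 1; ring
    rw [this, neg_div_neg_eq]
    ring
  have hFint : Integrable (Function.uncurry F)
      ((volume.restrict (Ioi 0)).prod (volume.restrict (Ioi z))) := by
    rw [integrable_prod_iff (by simp only [hF]; fun_prop)]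
    refine ⟨?_, ?_⟩
    · filter_upwards [self_mem_ae_restrict measurableSet_Ioi] with u hu
      have hu' : -(1 + u) < 0 := by have := mem_Ioi.1 hu; linarith
      have := (integrableOn_exp_mul_Ioi hu' z).const_mul (u ^ (k + 1))
      simpa only [hF, Function.uncurry, neg_mul] using this
    · have hdom : IntegrableOn (fun u : ℝ => u ^ (k + 1) * Real.exp (-(z * u))) (Ioi 0) :=
        integrableOn_pow_mul_exp_neg_mul (k + 1) hz0
      have hcongr : (fun u => ∫ t in Ioi z, ‖Function.uncurry F (u, t)‖)
          =ᵐ[volume.restrict (Ioi 0)]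
            fun u => u ^ (k + 1) * Real.exp (-(z * u)) / (1 + u) * Real.exp (-z) := by
        filter_upwards [self_mem_ae_restrict measurableSet_Ioi] with u hu
        rw [← hinner u hu]
        refine integral_congr_ae (.of_forall fun t => ?_)
        have hu' : 0 < u := hu
        simp only [Function.uncurry, hF]
        exact Real.norm_of_nonneg (by positivity)
      refine Integrable.congr (Integrable.mono' hdom ?_ ?_) hcongr.symm
      · have : Measurable fun u : ℝ =>
          u ^ (k + 1) * Real.exp (-(z * u)) / (1 + u) * Real.exp (-z) := by fun_prop
        exact this.aestronglyMeasurable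
      · filter_upwards [self_mem_ae_restrict measurableSet_Ioi] with u hu
        have hu' : 0 < u := hu
        rw [Real.norm_of_nonneg (by positivity)]
        have h1 : Real.exp (-z) ≤ 1 := Real.exp_le_one_iff.2 (by linarith)
        have h2 : u ^ (k + 1) * Real.exp (-(z * u)) / (1 + u)
            ≤ u ^ (k + 1) * Real.exp (-(z * u)) :=
          div_le_self (by positivity) (by linarith)
        calc _ ≤ u ^ (k + 1) * Real.exp (-(z * u)) / (1 + u) * 1 := by gcongr
          _ ≤ _ := by rw [mul_one]; exact h2
  have hswap := integral_integral_swap hFint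
  have houter : ∀ t ∈ Ioi z, ∫ u in Ioi 0, F u t
      = Real.Gamma (((k + 1 : ℕ) : ℝ) + 1)
        * (t ^ (-((k + 1 : ℕ) : ℝ) - 1) * Real.exp (-t)) := by
    intro t ht
    have ht0 : 0 < t := hz0.trans ht
    have h := Real.integral_rpow_mul_exp_neg_mul_Ioi (a := ((k + 1 : ℕ) : ℝ) + 1) (r := t)
      (by positivity) ht0
    have e : ∀ u : ℝ, F u t = Real.exp (-t)
        * (u ^ (((k + 1 : ℕ) : ℝ) + 1 - 1) * Real.exp (-(t * u))) := by
      intro u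
      simp only [hF]
      rw [add_sub_cancel_right, Real.rpow_natCast]
      have : Real.exp (-((1 + u) * t)) = Real.exp (-t) * Real.exp (-(t * u)) := by
        rw [← Real.exp_add]; congr 1; ring
      rw [this]; ring
    simp_rw [e]
    rw [integral_const_mul, h, one_div, Real.inv_rpow ht0.le, ← Real.rpow_neg ht0.le]
    ring_nf
  rw [setIntegral_congr_fun measurableSet_Ioi hinner,
    setIntegral_congr_fun measurableSet_Ioi houter, integral_mul_const, integral_const_mul] at hswap
  -- the substitution `u = P x` turns the `u`-integral into the left-hand side
  have hscale := integral_comp_mul_left_Ioi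
    (fun u : ℝ => u ^ (k + 1) * Real.exp (-(z * u)) / (1 + u)) 0 hP
  rw [mul_zero] at hscale
  have hlhs : ∀ x ∈ Ioi (0 : ℝ), x ^ k * Real.exp (-(lam * x)) * (P * x / (1 + P * x))
      = 1 / P ^ k * ((P * x) ^ (k + 1) * Real.exp (-(z * (P * x))) / (1 + P * x)) := by
    intro x hx
    have hx' : 0 < 1 + P * x := by have := mul_pos hP (mem_Ioi.1 hx); linarith
    rw [hlamz, mul_assoc z P x, mul_pow]
    field_simp
    ring
  rw [setIntegral_congr_fun measurableSet_Ioi hlhs, integral_const_mul, hscale, smul_eq_mul,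
    upperGamma, mul_assoc _ (Real.exp z), mul_assoc, mul_left_comm _ (Real.exp z), ← hswap,
    mul_comm (∫ x in Ioi (0 : ℝ), x ^ (k + 1) * Real.exp (-(z * x)) / (1 + x)),
    ← mul_assoc (Real.exp z), ← Real.exp_add, add_neg_cancel, Real.exp_zero, one_mul,
    ← mul_assoc, pow_succ]
  congr 1
  field_simp

/-- The beta integral `∫ u ^ (a - 1) / (1 + u) = Γ(a) Γ(1 - a)`, with convergence, from
`1 / (1 + u) = ∫ exp (-(1 + u) v) dv`. -/
lemma hasMellin_inv_one_add {a : ℂ} (ha0 : 0 < a.re) (ha1 : a.re < 1) :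
    HasMellin (fun u : ℝ => ((1 + u : ℝ) : ℂ)⁻¹) a
      (Complex.Gamma a * Complex.Gamma (1 - a)) := by
  set F : ℝ → ℝ → ℂ := fun u v => (u : ℂ) ^ (a - 1) * Complex.exp (-((1 + u) * v)) with hF
  have hFm : Measurable (Function.uncurry F) := by
    simp only [hF, Function.uncurry_def]
    fun_prop
  have hinner : ∀ u ∈ Ioi (0 : ℝ), ∫ v in Ioi 0, F u v
      = (u : ℂ) ^ (a - 1) • ((1 + u : ℝ) : ℂ)⁻¹ := by
    intro u hu
    have hu' : 0 < u := hu
    have h := integral_pow_mul_cexp 0 (z := ((1 + u : ℝ) : ℂ))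
      (by rw [Complex.ofReal_re]; positivity)
    simp only [hF]
    rw [integral_const_mul]
    simp only [pow_zero, one_mul, Nat.factorial_zero, Nat.cast_one, zero_add, pow_one, one_div] at h
    push_cast at h ⊢
    rw [h, smul_eq_mul]
  have hnorm : ∀ v ∈ Ioi (0 : ℝ), ∀ u ∈ Ioi (0 : ℝ), ‖F u v‖
      = Real.exp (-v) * (u ^ (a.re - 1) * Real.exp (-(v * u))) := by
    intro v hv u hu
    simp only [hF]
    rw [norm_mul, Complex.norm_cpow_eq_rpow_re_of_pos hu, Complex.norm_exp]
    have : Real.exp (-((1 + (u : ℂ)) * v)).re = Real.exp (-v) * Real.exp (-(v * u)) := by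
      rw [← Real.exp_add]
      congr 1
      simp
      ring
    rw [this]
    simp
    ring
  have hFint : Integrable (Function.uncurry F)
      ((volume.restrict (Ioi 0)).prod (volume.restrict (Ioi 0))) := by
    rw [integrable_prod_iff' hFm.aestronglyMeasurable]
    refine ⟨?_, ?_⟩
    · filter_upwards [self_mem_ae_restrict measurableSet_Ioi] with v hv
      have h := integrableOn_rpow_mul_exp_neg_mul_rpow (p := 1) (s := a.re - 1) (b := v)
        (by linarith) one_pos hv
      refine Integrable.mono' (h.const_mul (Real.exp (-v)))
        (hFm.comp measurable_prodMk_right).aestronglyMeasurable ?_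
      filter_upwards [self_mem_ae_restrict measurableSet_Ioi] with u hu
      refine (hnorm v hv u hu).le.trans_eq ?_
      simp
    · have hcongr : (fun v => ∫ u in Ioi 0, ‖Function.uncurry F (u, v)‖)
          =ᵐ[volume.restrict (Ioi 0)]
            fun v => Real.Gamma a.re * (v ^ (-a.re) * Real.exp (-1 * v ^ (1 : ℝ))) := by
        filter_upwards [self_mem_ae_restrict measurableSet_Ioi] with v hv
        have hv' : 0 < v := hv
        have := setIntegral_congr_fun (μ := volume) measurableSet_Ioi (hnorm v hv)
        simp only [Function.uncurry]
        rw [this, integral_const_mul, Real.integral_rpow_mul_exp_neg_mul_Ioi ha0 hv, one_div,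
          Real.inv_rpow hv'.le, ← Real.rpow_neg hv'.le, Real.rpow_one, neg_one_mul]
        ring
      exact ((integrableOn_rpow_mul_exp_neg_mul_rpow (by linarith) one_pos one_pos).const_mul
        _).congr hcongr.symm
  have hconv : MellinConvergent (fun u : ℝ => ((1 + u : ℝ) : ℂ)⁻¹) a := by
    refine hFint.integral_prod_left.congr ?_
    filter_upwards [self_mem_ae_restrict measurableSet_Ioi] with u hu
    exact hinner u hu
  refine ⟨hconv, ?_⟩
  have hswap := integral_integral_swap hFint
  rw [setIntegral_congr_fun measurableSet_Ioi hinner] at hswap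
  rw [mellin, hswap]
  have houter : ∀ v ∈ Ioi (0 : ℝ), ∫ u in Ioi 0, F u v
      = Complex.Gamma a * (Complex.exp (-v) * (v : ℂ) ^ ((1 - a) - 1)) := by
    intro v hv
    have hv' : 0 < v := hv
    have h := Complex.integral_cpow_mul_exp_neg_mul_Ioi ha0 hv'
    have e : ∀ u : ℝ, F u v
        = Complex.exp (-v) * ((u : ℂ) ^ (a - 1) * Complex.exp (-(v * u))) := by
      intro u
      simp only [hF]
      have : Complex.exp (-((1 + u) * v)) = Complex.exp (-v) * Complex.exp (-(v * u)) := by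
        rw [← Complex.exp_add]; congr 1; ring
      rw [this]; ring
    simp_rw [e]
    rw [integral_const_mul, h, one_div, Complex.inv_cpow _ _
      (by rw [Complex.arg_ofReal_of_nonneg hv'.le]; exact Real.pi_ne_zero.symm),
      ← Complex.cpow_neg, show (1 : ℂ) - a - 1 = -a by ring]
    ring
  rw [setIntegral_congr_fun measurableSet_Ioi houter, integral_const_mul,
    Complex.Gamma_eq_integral (s := 1 - a) (by simpa using ha1), Complex.GammaIntegral]
  simp

lemma integral_div_one_add_mul {u : ℝ} (hu : 0 < u) :
    ∫ y in Ioc (0 : ℝ) 1, u / (1 + y * u) = Real.log (1 + u) := by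
  rw [← intervalIntegral.integral_of_le zero_le_one]
  have hpos : ∀ y ∈ uIcc (0 : ℝ) 1, 0 < 1 + y * u := by
    intro y hy
    rw [uIcc_of_le zero_le_one] at hy
    have := mul_nonneg hy.1 hu.le
    linarith
  have h := intervalIntegral.integral_eq_sub_of_hasDerivAt (a := 0) (b := 1)
    (f := fun y : ℝ => Real.log (1 + y * u)) (f' := fun y => u / (1 + y * u))
    (fun y hy => by
      have h1 : HasDerivAt (fun y : ℝ => 1 + y * u) (1 * u) y :=
        ((hasDerivAt_id y).mul_const u).const_add 1
      simpa using h1.log (hpos y hy).ne')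
    (ContinuousOn.intervalIntegrable (ContinuousOn.div (by fun_prop) (by fun_prop)
      fun y hy => (hpos y hy).ne'))
  simpa using h

/-- The Mellin transform of `log (1 + u)`, from `log (1 + u) = ∫ y in 0..1, u / (1 + y u)`. -/
lemma hasMellin_log_one_add {s : ℂ} (hs0 : -1 < s.re) (hs1 : s.re < 0) :
    HasMellin (fun u : ℝ => (Real.log (1 + u) : ℂ)) s
      (Complex.Gamma (s + 1) * Complex.Gamma (-s) / (-s)) := by
  have hs : s ≠ 0 := by rintro rfl; simp at hs1
  have ha0 : 0 < (s + 1).re := by simp; linarith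
  have ha1 : (s + 1).re < 1 := by simpa using hs1
  set φ : ℝ → ℂ := fun u => ((1 + u : ℝ) : ℂ)⁻¹ with hφ
  obtain ⟨hB, hBv⟩ := hasMellin_inv_one_add ha0 ha1
  rw [← hφ] at hB hBv
  set F : ℝ → ℝ → ℂ := fun u y => (u : ℂ) ^ s * φ (y * u) with hF
  have hFm : Measurable (Function.uncurry F) := by
    simp only [hF, hφ, Function.uncurry_def]
    fun_prop
  have hinner : ∀ u ∈ Ioi (0 : ℝ), ∫ y in Ioc 0 1, F u y
      = (u : ℂ) ^ (s - 1) • (Real.log (1 + u) : ℂ) := by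
    intro u hu
    have hu' : 0 < u := hu
    have hu0 : (u : ℂ) ≠ 0 := by exact_mod_cast hu'.ne'
    rw [← integral_div_one_add_mul hu', ← integral_complex_ofReal, smul_eq_mul,
      ← integral_const_mul]
    refine integral_congr_ae (.of_forall fun y => ?_)
    simp only [hF, hφ]
    rw [Complex.cpow_sub _ _ hu0, Complex.cpow_one]
    push_cast
    field_simp
  have hscale : ∀ y ∈ Ioc (0 : ℝ) 1,
      IntegrableOn (fun u => F u y) (Ioi 0) ∧
        ∫ u in Ioi 0, F u y = (y : ℂ) ^ (-(s + 1)) * mellin φ (s + 1) := by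
    intro y hy
    have h1 := (MellinConvergent.comp_mul_left hy.1).2 hB
    have h2 := mellin_comp_mul_left φ (s + 1) hy.1
    rw [MellinConvergent] at h1
    rw [mellin, smul_eq_mul] at h2
    simp only [add_sub_cancel_right, smul_eq_mul] at h1 h2
    exact ⟨h1, h2⟩
  have hnorm : ∀ y ∈ Ioc (0 : ℝ) 1, ∫ u in Ioi 0, ‖F u y‖
      = y ^ (-(s.re + 1)) * ∫ u in Ioi (0 : ℝ), ‖(u : ℂ) ^ s * φ u‖ := by
    intro y hy
    have h := integral_comp_mul_left_Ioi (fun u : ℝ => ‖(u : ℂ) ^ s * φ u‖) 0 hy.1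
    rw [mul_zero, smul_eq_mul] at h
    have h3 : ∀ u ∈ Ioi (0 : ℝ), ‖F u y‖ = y ^ (-s.re) * ‖((y * u : ℝ) : ℂ) ^ s * φ (y * u)‖ := by
      intro u hu
      simp only [hF]
      rw [norm_mul, norm_mul, Complex.norm_cpow_eq_rpow_re_of_pos hu,
        Complex.norm_cpow_eq_rpow_re_of_pos (mul_pos hy.1 hu),
        Real.mul_rpow hy.1.le (le_of_lt hu), ← mul_assoc, ← mul_assoc, ← Real.rpow_add hy.1]
      simp
    rw [setIntegral_congr_fun measurableSet_Ioi h3, integral_const_mul, h, neg_add,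
      Real.rpow_add hy.1, Real.rpow_neg_one]
    ring
  have hFint : Integrable (Function.uncurry F)
      ((volume.restrict (Ioi 0)).prod (volume.restrict (Ioc 0 1))) := by
    rw [integrable_prod_iff' hFm.aestronglyMeasurable]
    refine ⟨?_, ?_⟩
    · filter_upwards [self_mem_ae_restrict measurableSet_Ioc] with y hy
      exact (hscale y hy).1
    · have hpow : IntegrableOn (fun y : ℝ => y ^ (-(s.re + 1))) (Ioc 0 1) := by
        rw [← intervalIntegrable_iff_integrableOn_Ioc_of_le zero_le_one]
        exact intervalIntegral.intervalIntegrable_rpow' (by linarith)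
      refine (hpow.mul_const (∫ u in Ioi (0 : ℝ), ‖(u : ℂ) ^ s * φ u‖)).congr ?_
      filter_upwards [self_mem_ae_restrict measurableSet_Ioc] with y hy
      exact (hnorm y hy).symm
  refine ⟨?_, ?_⟩
  · refine hFint.integral_prod_left.congr ?_
    filter_upwards [self_mem_ae_restrict measurableSet_Ioi] with u hu
    exact hinner u hu
  · have hswap := integral_integral_swap hFint
    rw [setIntegral_congr_fun measurableSet_Ioi hinner,
      setIntegral_congr_fun measurableSet_Ioc fun y hy => (hscale y hy).2,
      integral_mul_const, hBv, ← intervalIntegral.integral_of_le zero_le_one,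
      integral_cpow (Or.inl (by simp; linarith))] at hswap
    rw [mellin, hswap]
    rw [show -(s + 1) + 1 = -s by ring, show (1 : ℂ) - (s + 1) = -s by ring]
    rw [Complex.ofReal_one, Complex.one_cpow, Complex.ofReal_zero,
      Complex.zero_cpow (neg_ne_zero.2 hs)]
    ring

/-! ### The Meijer G-function by Mellin inversion -/

lemma Gamma_mul_Gamma_div_neg (s : ℂ) :
    Complex.Gamma (s + 1) * Complex.Gamma (-s) / (-s)
      = Real.pi / (s * Complex.sin (Real.pi * s)) := by
  have h := Complex.Gamma_mul_Gamma_one_sub (-s)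
  rw [show 1 - -s = s + 1 by ring, mul_neg, Complex.sin_neg] at h
  rw [mul_comm (Complex.Gamma (s + 1)), h, div_neg, div_neg, neg_div, neg_neg, div_div,
    mul_comm s]

lemma sin_sq_add_sq_le_norm_sin_sq (c t : ℝ) :
    Real.sin c ^ 2 + t ^ 2 ≤ ‖Complex.sin (c + t * Complex.I)‖ ^ 2 := by
  have e : Complex.sin (c + t * Complex.I)
      = ((Real.sin c * Real.cosh t : ℝ) : ℂ) + ((Real.cos c * Real.sinh t : ℝ) : ℂ) * Complex.I := by
    rw [Complex.sin_add_mul_I]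
    push_cast
    ring
  have h1 : ‖Complex.sin (c + t * Complex.I)‖ ^ 2
      = (Real.sin c * Real.cosh t) ^ 2 + (Real.cos c * Real.sinh t) ^ 2 := by
    rw [e, ← Complex.normSq_eq_norm_sq, Complex.normSq_add_mul_I]
  have h2 : t ^ 2 ≤ Real.sinh t ^ 2 := by
    rw [sq_le_sq, Real.abs_sinh]
    exact Real.self_le_sinh_iff.2 (abs_nonneg t)
  have h3 := Real.cosh_sq t
  have h4 := Real.sin_sq_add_cos_sq c
  rw [h1, mul_pow, mul_pow, h3]
  nlinarith

lemma sin_pi_mul_ne_zero {c : ℝ} (hc0 : -1 < c) (hc1 : c < 0) : Real.sin (Real.pi * c) ≠ 0 := by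
  have hpi := Real.pi_pos
  exact (Real.sin_neg_of_neg_of_neg_pi_lt (by nlinarith) (by nlinarith)).ne

lemma norm_mul_sin_ge {c : ℝ} (hc0 : -1 < c) (hc1 : c < 0) (t : ℝ) :
    |c| * |Real.sin (Real.pi * c)| * (1 + t ^ 2)
      ≤ ‖(c + t * Complex.I) * Complex.sin (Real.pi * (c + t * Complex.I))‖ := by
  rw [norm_mul]
  have hpi := Real.pi_gt_three
  have hs := sin_sq_add_sq_le_norm_sin_sq (Real.pi * c) (Real.pi * t)
  have e : ((Real.pi * c : ℝ) : ℂ) + ((Real.pi * t : ℝ) : ℂ) * Complex.I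
      = Real.pi * (c + t * Complex.I) := by push_cast; ring
  rw [e] at hs
  have hn : ‖(c : ℂ) + t * Complex.I‖ ^ 2 = c ^ 2 + t ^ 2 := by
    rw [← Complex.normSq_eq_norm_sq, Complex.normSq_add_mul_I]
  have hc2 : c ^ 2 ≤ 1 := by nlinarith
  have hsin := Real.sin_sq_le_one (Real.pi * c)
  refine le_of_sq_le_sq ?_ (by positivity)
  rw [mul_pow, mul_pow, mul_pow, hn, sq_abs, sq_abs]
  have h1 : c ^ 2 * (1 + t ^ 2) ≤ c ^ 2 + t ^ 2 := by nlinarith [sq_nonneg t]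
  have h2 : Real.sin (Real.pi * c) ^ 2 * (1 + t ^ 2)
      ≤ ‖Complex.sin (Real.pi * (c + t * Complex.I))‖ ^ 2 := by
    refine le_trans ?_ hs
    have hpi2 : 1 ≤ Real.pi ^ 2 := by nlinarith
    have : t ^ 2 ≤ (Real.pi * t) ^ 2 := by
      rw [mul_pow]; exact le_mul_of_one_le_left (sq_nonneg t) hpi2
    nlinarith [sq_nonneg t]
  calc c ^ 2 * Real.sin (Real.pi * c) ^ 2 * (1 + t ^ 2) ^ 2
      = (c ^ 2 * (1 + t ^ 2)) * (Real.sin (Real.pi * c) ^ 2 * (1 + t ^ 2)) := by ring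
    _ ≤ _ := by gcongr

/-- The Mellin transform `π / (s sin (π s))` of `log (1 + u)` decays like `1 / t ^ 2` along
vertical lines. -/
lemma integrable_pi_div_mul_sin {c : ℝ} (hc0 : -1 < c) (hc1 : c < 0) :
    Integrable fun t : ℝ => (Real.pi : ℂ)
      / ((c + t * Complex.I) * Complex.sin (Real.pi * (c + t * Complex.I))) := by
  have hA : 0 < |c| * |Real.sin (Real.pi * c)| :=
    mul_pos (abs_pos.2 hc1.ne) (abs_pos.2 (sin_pi_mul_ne_zero hc0 hc1))
  refine (integrable_inv_one_add_sq.const_mul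
    (Real.pi / (|c| * |Real.sin (Real.pi * c)|))).mono' ?_ (.of_forall fun t => ?_)
  · have : Measurable fun t : ℝ => (Real.pi : ℂ)
      / ((c + t * Complex.I) * Complex.sin (Real.pi * (c + t * Complex.I))) := by fun_prop
    exact this.aestronglyMeasurable
  · rw [norm_div, Complex.norm_real, Real.norm_of_nonneg Real.pi_pos.le]
    calc _ ≤ Real.pi / (|c| * |Real.sin (Real.pi * c)| * (1 + t ^ 2)) :=
          div_le_div_of_nonneg_left Real.pi_pos.le (by positivity) (norm_mul_sin_ge hc0 hc1 t)
      _ = _ := by rw [← div_div, div_eq_mul_inv _ (1 + t ^ 2)]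

lemma mellin_log_one_add_line {c : ℝ} (hc0 : -1 < c) (hc1 : c < 0) (t : ℝ) :
    mellin (fun u : ℝ => (Real.log (1 + u) : ℂ)) (c + t * Complex.I) = (Real.pi : ℂ)
      / ((c + t * Complex.I) * Complex.sin (Real.pi * (c + t * Complex.I))) := by
  rw [(hasMellin_log_one_add (s := c + t * Complex.I) (by simpa using hc0)
    (by simpa using hc1)).2, Gamma_mul_Gamma_div_neg]

/-- Mellin inversion for `log (1 + w)`. -/
lemma integral_cpow_mul_pi_div_mul_sin {c : ℝ} (hc0 : -1 < c) (hc1 : c < 0) {w : ℝ}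
    (hw : 0 < w) :
    ∫ t : ℝ, (w : ℂ) ^ (-(c + t * Complex.I)) * ((Real.pi : ℂ)
      / ((c + t * Complex.I) * Complex.sin (Real.pi * (c + t * Complex.I))))
      = 2 * Real.pi * Real.log (1 + w) := by
  have hinv := mellinInv_mellin_eq c (fun u : ℝ => (Real.log (1 + u) : ℂ)) hw
    (hasMellin_log_one_add (s := (c : ℂ)) (by simpa using hc0) (by simpa using hc1)).1
    (by
      rw [Complex.VerticalIntegrable]
      simp_rw [mellin_log_one_add_line hc0 hc1]
      exact integrable_pi_div_mul_sin hc0 hc1)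
    (by
      have h1 : ContinuousAt (fun u : ℝ => Real.log (1 + u)) w :=
        ContinuousAt.log (by fun_prop) (by positivity)
      exact Complex.continuous_ofReal.continuousAt.comp h1)
  rw [mellinInv] at hinv
  simp_rw [mellin_log_one_add_line hc0 hc1, smul_eq_mul] at hinv
  have h2pi : 2 * (Real.pi : ℂ) * ((1 / (2 * Real.pi) : ℝ) : ℂ) = 1 := by
    have := Real.pi_ne_zero
    push_cast
    field_simp
  rw [← hinv, Complex.real_smul, ← mul_assoc, h2pi, one_mul]

/-- Integration of the inversion formula for `log (1 + P x)` against an Erlang density. -/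
lemma integral_line_eq_integral_erlang_log (k : ℕ) {lam P : ℝ} (hlam : 0 < lam) (hP : 0 < P)
    {c : ℝ} (hc0 : -1 < c) (hc1 : c < 0) :
    ∫ t : ℝ, ((Real.pi : ℂ)
        / ((c + t * Complex.I) * Complex.sin (Real.pi * (c + t * Complex.I))))
        * (Complex.Gamma ((k + 1 : ℕ) - (c + t * Complex.I))
          * ((lam / P : ℝ) : ℂ) ^ ((c : ℂ) + t * Complex.I))
      = ((2 * Real.pi * (lam ^ (k + 1) * ∫ x in Ioi 0,
          x ^ k * Real.exp (-(lam * x)) * Real.log (1 + P * x)) : ℝ) : ℂ) := by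
  set m : ℝ → ℂ := fun t => (Real.pi : ℂ)
      / ((c + t * Complex.I) * Complex.sin (Real.pi * (c + t * Complex.I))) with hm
  have hmi : Integrable m := integrable_pi_div_mul_sin hc0 hc1
  have hmm : Measurable m := by simp only [hm]; fun_prop
  set F : ℝ → ℝ → ℂ := fun x t => ((x ^ k * Real.exp (-(lam * x)) : ℝ) : ℂ)
    * (((P * x : ℝ) : ℂ) ^ (-((c : ℂ) + t * Complex.I)) * m t) with hF
  have hFm : Measurable (Function.uncurry F) := by
    simp only [hF, Function.uncurry_def]
    fun_prop
  have hnorm : ∀ x ∈ Ioi (0 : ℝ), ∀ t, ‖F x t‖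
      = (P ^ (-c) * (x ^ ((k : ℝ) - c) * Real.exp (-lam * x ^ (1 : ℝ)))) * ‖m t‖ := by
    intro x hx t
    have hx' : 0 < x := hx
    simp only [hF]
    rw [norm_mul, norm_mul, Complex.norm_cpow_eq_rpow_re_of_pos (mul_pos hP hx'),
      Complex.norm_real, Real.norm_of_nonneg (by positivity), Real.mul_rpow hP.le hx'.le,
      sub_eq_add_neg, Real.rpow_add hx', Real.rpow_natCast]
    simp
    ring
  have hFint : Integrable (Function.uncurry F) ((volume.restrict (Ioi 0)).prod volume) := by
    have h1 := (integrableOn_rpow_mul_exp_neg_mul_rpow (p := 1) (s := (k : ℝ) - c) (b := lam)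
      (by have := Nat.cast_nonneg (α := ℝ) k; linarith) one_pos hlam).const_mul (P ^ (-c))
    have h2 := Integrable.mul_prod h1 hmi.norm
    refine h2.mono' hFm.aestronglyMeasurable ?_
    have : ∀ᵐ z : ℝ × ℝ ∂(volume.restrict (Ioi 0)).prod volume, z.1 ∈ Ioi (0 : ℝ) :=
      Measure.quasiMeasurePreserving_fst.ae (self_mem_ae_restrict measurableSet_Ioi)
    filter_upwards [this] with z hz
    exact (hnorm z.1 hz z.2).le
  have hswap := integral_integral_swap hFint
  have hinner : ∀ x ∈ Ioi (0 : ℝ), ∫ t, F x t = ((2 * Real.pi *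
      (x ^ k * Real.exp (-(lam * x)) * Real.log (1 + P * x)) : ℝ) : ℂ) := by
    intro x hx
    simp only [hF]
    rw [integral_const_mul, integral_cpow_mul_pi_div_mul_sin hc0 hc1 (mul_pos hP hx)]
    push_cast
    ring
  have houter : ∀ t : ℝ, ∫ x in Ioi 0, F x t
      = ((1 / lam : ℝ) : ℂ) ^ (k + 1) * (m t * (Complex.Gamma ((k + 1 : ℕ) - (c + t * Complex.I))
          * ((lam / P : ℝ) : ℂ) ^ ((c : ℂ) + t * Complex.I))) := by
    intro t
    set s : ℂ := (c : ℂ) + t * Complex.I with hs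
    have hsre : s.re = c := by simp [hs]
    have hre : 0 < (((k + 1 : ℕ) : ℂ) - s).re := by
      rw [Complex.sub_re, Complex.natCast_re, hsre]
      have := Nat.cast_nonneg (α := ℝ) (k + 1)
      linarith
    have h := Complex.integral_cpow_mul_exp_neg_mul_Ioi hre hlam
    have e : ∀ x ∈ Ioi (0 : ℝ), F x t = (P : ℂ) ^ (-s) * m t
        * ((x : ℂ) ^ (((k + 1 : ℕ) : ℂ) - s - 1) * Complex.exp (-(lam * x))) := by
      intro x hx
      have hx' : 0 < x := hx
      have hx0 : (x : ℂ) ≠ 0 := by exact_mod_cast hx'.ne'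
      simp only [hF]
      rw [Complex.ofReal_mul P x, Complex.mul_cpow_ofReal_nonneg hP.le hx'.le,
        show ((k + 1 : ℕ) : ℂ) - s - 1 = (k : ℂ) + -s by push_cast; ring,
        Complex.cpow_add _ _ hx0, Complex.cpow_natCast]
      push_cast
      ring
    rw [setIntegral_congr_fun measurableSet_Ioi e, integral_const_mul, h]
    have hl : ((1 / lam : ℝ) : ℂ) ≠ 0 := by
      have : (1 / lam : ℝ) ≠ 0 := by positivity
      exact_mod_cast this
    have h1 : (1 / (lam : ℂ)) ^ (((k + 1 : ℕ) : ℂ) - s)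
        = ((1 / lam : ℝ) : ℂ) ^ (k + 1) * ((1 / lam : ℝ) : ℂ) ^ (-s) := by
      rw [sub_eq_add_neg, show (1 / (lam : ℂ)) = ((1 / lam : ℝ) : ℂ) by push_cast; ring,
        Complex.cpow_add _ _ hl, Complex.cpow_natCast]
    have h2 : ((lam / P : ℝ) : ℂ) ^ s = ((1 / lam : ℝ) : ℂ) ^ (-s) * (P : ℂ) ^ (-s) := by
      rw [← Complex.mul_cpow_ofReal_nonneg (by positivity) hP.le, Complex.cpow_neg,
        ← Complex.inv_cpow]
      · congr 1
        push_cast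
        field_simp
      · rw [← Complex.ofReal_mul, Complex.arg_ofReal_of_nonneg (by positivity)]
        exact Real.pi_ne_zero.symm
    rw [h1, h2]
    ring
  rw [setIntegral_congr_fun measurableSet_Ioi hinner, integral_congr_ae (.of_forall houter),
    integral_const_mul, integral_complex_ofReal, integral_const_mul] at hswap
  have hl : (lam : ℂ) ≠ 0 := by exact_mod_cast hlam.ne'
  have hfin : ∀ A B : ℂ, A = ((1 / lam : ℝ) : ℂ) ^ (k + 1) * B → B = (lam : ℂ) ^ (k + 1) * A := by
    rintro A B rfl
    push_cast
    rw [one_div, inv_pow]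
    field_simp
  rw [hfin _ _ hswap]
  push_cast
  ring

lemma meijerIntegrand_eq (M : ℕ) (z : ℂ) {s : ℂ} (hs1 : s.re < 0) :
    meijerIntegrand [0] [1] [0, 0, (M : ℂ)] [] z s
      = (Real.pi / (s * Complex.sin (Real.pi * s))) * (Complex.Gamma (M - s) * z ^ s) := by
  have hs : -s ≠ 0 := by
    rw [neg_ne_zero]; rintro rfl; simp at hs1
  have hG : Complex.Gamma (-s) ≠ 0 :=
    Complex.Gamma_ne_zero_of_re_pos (by simpa using hs1)
  have h1 : Complex.Gamma (1 - s) = -s * Complex.Gamma (-s) := by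
    rw [← Complex.Gamma_add_one _ hs]; congr 1; ring
  rw [← Gamma_mul_Gamma_div_neg]
  simp only [meijerIntegrand, List.map_cons, List.map_nil, List.prod_cons, List.prod_nil, zero_sub,
    sub_zero, mul_one, one_mul, h1, add_comm (1 : ℂ) s]
  field_simp

/-- The Meijer G-function of the closed form is the Laplace-type integral it stands for. -/
lemma meijerTerm_eq (k : ℕ) {lam P : ℝ} (hlam : 0 < lam) (hP : 0 < P) :
    meijerTerm (k + 1) lam P = ((lam ^ (k + 1) * ∫ x in Ioi 0,
      x ^ k * Real.exp (-(lam * x)) * Real.log (1 + P * x) : ℝ) : ℂ) := by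
  have hsep : ∃ c : ℝ, Separates [0] [0, 0, ((k + 1 : ℕ) : ℂ)] c := by
    refine ⟨-1 / 2, ?_, ?_⟩
    · intro b hb
      simp only [List.mem_cons, List.not_mem_nil, or_false] at hb
      rcases hb with rfl | rfl | rfl
      · norm_num
      · norm_num
      · rw [Complex.natCast_re]
        have := Nat.cast_nonneg (α := ℝ) (k + 1)
        linarith
    · intro a ha
      simp only [List.mem_cons, List.not_mem_nil, or_false] at ha
      subst ha
      norm_num
  -- the chosen line is arbitrary: all that matters is `-1 < c < 0`
  rw [meijerTerm, meijerG, dif_pos hsep]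
  obtain ⟨hb, ha⟩ := hsep.choose_spec
  set c := hsep.choose
  have hc1 : c < 0 := by simpa using hb 0 (by simp)
  have hc0 : -1 < c := by simpa using ha 0 (by simp)
  have hline := integral_line_eq_integral_erlang_log k hlam hP hc0 hc1
  rw [integral_mul_const]
  have e : ∀ t : ℝ, meijerIntegrand [0] [1] [0, 0, ((k + 1 : ℕ) : ℂ)] []
      ((lam / P : ℝ) : ℂ) (c + t * Complex.I) = _ := fun t =>
    meijerIntegrand_eq (k + 1) _ (s := c + t * Complex.I) (by simpa using hc1)
  rw [integral_congr_ae (.of_forall e), hline]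
  have := Real.pi_ne_zero
  generalize (∫ x in Ioi (0 : ℝ), x ^ k * Real.exp (-(lam * x)) * Real.log (1 + P * x)) = J
  push_cast
  field_simp

/-! ### The averaged divergence -/

lemma divergence_pos {x : ℝ} (hx : 0 < x) : 0 < divergence x := by
  have h1 : 0 < 1 + x := by linarith
  have h := Real.log_lt_sub_one_of_pos (inv_pos.2 h1) (inv_lt_one_of_one_lt₀ (by linarith)).ne
  rw [Real.log_inv] at h
  have e : x / (1 + x) = 1 - (1 + x)⁻¹ := by field_simp; ring
  rw [divergence, e]
  linarith

lemma measurable_divergence : Measurable divergence := by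
  unfold divergence; fun_prop

lemma ae_gammaMeasure_pos {a r : ℝ} : ∀ᵐ x ∂gammaMeasure a r, 0 < x := by
  rw [gammaMeasure_eq_restrict]
  exact (withDensity_absolutelyContinuous _ _).ae_le (self_mem_ae_restrict measurableSet_Ioi)

lemma log_one_add_mul_le {P x : ℝ} (hP : 0 < P) (hx : 0 < x) :
    Real.log (1 + P * x) ≤ Real.log (1 + P) + x := by
  have h1 := Real.log_le_sub_one_of_pos (show 0 < 1 + x by linarith)
  have hPx := mul_pos hP hx
  calc Real.log (1 + P * x) ≤ Real.log ((1 + P) * (1 + x)) :=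
        Real.log_le_log (by linarith) (by nlinarith)
    _ = Real.log (1 + P) + Real.log (1 + x) := Real.log_mul (by linarith) (by linarith)
    _ ≤ _ := by linarith

lemma integrable_id_gammaMeasure (k : ℕ) {lam : ℝ} (hlam : 0 < lam) :
    Integrable (fun x => x) (gammaMeasure ((k + 1 : ℕ) : ℝ) lam) := by
  rw [integrable_gammaMeasure_iff k hlam]
  refine (integrableOn_pow_mul_exp_neg_mul (k + 1) hlam).congr_fun (fun x _ => ?_)
    measurableSet_Ioi
  simp only [smul_eq_mul]
  ring

lemma integrable_log_gammaMeasure (k : ℕ) {lam P : ℝ} (hlam : 0 < lam) (hP : 0 < P) :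
    Integrable (fun x => Real.log (1 + P * x)) (gammaMeasure ((k + 1 : ℕ) : ℝ) lam) := by
  have := isProbabilityMeasure_gammaMeasure (a := ((k + 1 : ℕ) : ℝ)) (by positivity) hlam
  have hm : Measurable fun x : ℝ => Real.log (1 + P * x) := by fun_prop
  refine ((integrable_const (Real.log (1 + P))).add (integrable_id_gammaMeasure k hlam)).mono'
    hm.aestronglyMeasurable ?_
  filter_upwards [ae_gammaMeasure_pos] with x hx
  have := mul_pos hP hx
  rw [Real.norm_of_nonneg (Real.log_nonneg (by linarith))]
  exact log_one_add_mul_le hP hx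

lemma integrable_div_gammaMeasure (k : ℕ) {lam P : ℝ} (hlam : 0 < lam) (hP : 0 < P) :
    Integrable (fun x => P * x / (1 + P * x)) (gammaMeasure ((k + 1 : ℕ) : ℝ) lam) := by
  have := isProbabilityMeasure_gammaMeasure (a := ((k + 1 : ℕ) : ℝ)) (by positivity) hlam
  have hm : Measurable fun x : ℝ => P * x / (1 + P * x) := by fun_prop
  refine (integrable_const (1 : ℝ)).mono' hm.aestronglyMeasurable ?_
  filter_upwards [ae_gammaMeasure_pos] with x hx
  have := mul_pos hP hx
  rw [Real.norm_of_nonneg (by positivity), div_le_one (by linarith)]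
  linarith

lemma integrable_divergence_gammaMeasure (k : ℕ) {lam P : ℝ} (hlam : 0 < lam) (hP : 0 < P) :
    Integrable (fun x => divergence (P * x)) (gammaMeasure ((k + 1 : ℕ) : ℝ) lam) :=
  (integrable_log_gammaMeasure k hlam hP).sub (integrable_div_gammaMeasure k hlam hP)

/-- The closed form `g` is the divergence averaged over the Erlang distribution. -/
lemma g_eq_integral (k : ℕ) {lam P : ℝ} (hlam : 0 < lam) (hP : 0 < P) :
    g (k + 1) lam P = ∫ x, divergence (P * x) ∂gammaMeasure ((k + 1 : ℕ) : ℝ) lam := by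
  unfold divergence
  rw [integral_sub (integrable_log_gammaMeasure k hlam hP) (integrable_div_gammaMeasure k hlam hP),
    integral_gammaMeasure k hlam, integral_gammaMeasure k hlam]
  simp_rw [smul_eq_mul, mul_assoc]
  rw [integral_const_mul, integral_const_mul, g, meijerTerm_eq k hlam hP, Complex.ofReal_re,
    ← integral_erlang_div k hlam hP, Nat.add_sub_cancel]
  simp_rw [mul_assoc]
  rw [← mul_assoc (1 / lam ^ (k + 1)), one_div_mul_cancel (by positivity), one_mul, mul_sub]

lemma g_pos (k : ℕ) {lam P : ℝ} (hlam : 0 < lam) (hP : 0 < P) : 0 < g (k + 1) lam P := by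
  have := isProbabilityMeasure_gammaMeasure (a := ((k + 1 : ℕ) : ℝ)) (by positivity) hlam
  have hpos : ∀ᵐ x ∂gammaMeasure ((k + 1 : ℕ) : ℝ) lam, 0 < divergence (P * x) := by
    filter_upwards [ae_gammaMeasure_pos] with x hx using divergence_pos (mul_pos hP hx)
  rw [g_eq_integral k hlam hP]
  have hnn : 0 ≤ᵐ[gammaMeasure ((k + 1 : ℕ) : ℝ) lam] fun x => divergence (P * x) := by
    filter_upwards [hpos] with x hx using hx.le
  refine lt_of_le_of_ne (integral_nonneg_of_ae hnn) fun h0 => ?_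
  have hz := (integral_eq_zero_iff_of_nonneg_ae hnn
    (integrable_divergence_gammaMeasure k hlam hP)).1 h0.symm
  obtain ⟨x, hx, hx0⟩ := (hpos.and hz).exists
  exact hx.ne' hx0

lemma g_le (k : ℕ) {lam : ℝ} (hlam : 0 < lam) :
    ∃ C : ℝ, 0 ≤ C ∧ ∀ P : ℝ, 0 < P → g (k + 1) lam P ≤ Real.log (1 + P) + C := by
  have := isProbabilityMeasure_gammaMeasure (a := ((k + 1 : ℕ) : ℝ)) (by positivity) hlam
  refine ⟨∫ x, x ∂gammaMeasure ((k + 1 : ℕ) : ℝ) lam, integral_nonneg_of_ae ?_, fun P hP => ?_⟩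
  · filter_upwards [ae_gammaMeasure_pos] with x hx using le_of_lt hx
  rw [g_eq_integral k hlam hP]
  have hi := (integrable_const (Real.log (1 + P))).add (integrable_id_gammaMeasure k hlam)
  have e : Real.log (1 + P) + ∫ x, x ∂gammaMeasure ((k + 1 : ℕ) : ℝ) lam
      = ∫ x, (Real.log (1 + P) + x) ∂gammaMeasure ((k + 1 : ℕ) : ℝ) lam := by
    rw [integral_add (integrable_const _) (integrable_id_gammaMeasure k hlam), integral_const,
      probReal_univ, one_smul]
  rw [e]
  refine integral_mono_ae (integrable_divergence_gammaMeasure k hlam hP) hi ?_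
  filter_upwards [ae_gammaMeasure_pos] with x hx
  have hx' := mul_pos hP hx
  have : 0 ≤ P * x / (1 + P * x) := by positivity
  have := log_one_add_mul_le hP hx
  simp only [divergence]
  linarith

lemma hasLaw_normSqVec {Ω : Type*} [MeasurableSpace Ω] {μ : Measure Ω} [IsProbabilityMeasure μ]
    {k : ℕ} {lam : ℝ} (hlam : 0 < lam) {h : Ω → Fin (k + 1) → ℂ} (hray : IsRayleigh μ h lam) :
    HasLaw (fun ω => normSqVec (h ω)) (gammaMeasure ((k + 1 : ℕ) : ℝ) lam) μ :=
  hasLaw_sum_gammaMeasure hlam hray.indep hray.law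

lemma expectedKL_eq {Ω : Type*} [MeasurableSpace Ω] {μ : Measure Ω} [IsProbabilityMeasure μ]
    {k : ℕ} {lam : ℝ} (hlam : 0 < lam) {h : Ω → Fin (k + 1) → ℂ} (hray : IsRayleigh μ h lam)
    {P : ℝ} (hP : 0 < P) (n : ℕ) :
    expectedKL μ h P n = ENNReal.ofReal (n * g (k + 1) lam P) := by
  unfold expectedKL
  simp_rw [klDiv_lawSilent_lawTransmit n hP]
  have hm : Measurable fun x : ℝ => ENNReal.ofReal (n * divergence (P * x)) :=
    ((measurable_divergence.comp (measurable_const_mul P)).const_mul (n : ℝ)).ennreal_ofReal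
  rw [(hasLaw_normSqVec hlam hray).lintegral_comp
      (f := fun x => ENNReal.ofReal (n * divergence (P * x))) hm.aemeasurable,
    ← ofReal_integral_eq_lintegral_ofReal
      ((integrable_divergence_gammaMeasure k hlam hP).const_mul _) ?_,
    integral_const_mul, g_eq_integral k hlam hP]
  filter_upwards [ae_gammaMeasure_pos] with x hx
  exact mul_nonneg n.cast_nonneg (divergence_pos (mul_pos hP hx)).le

/-! ### The Gaussian tail function -/

lemma gaussianQ_eq_one_sub_cdf (x : ℝ) : gaussianQ x = 1 - cdf (gaussianReal 0 1) x := by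
  rw [gaussianQ, cdf_eq_real, ← compl_Iic, probReal_compl_eq_one_sub measurableSet_Iic]

lemma continuous_cdf_gaussianReal : Continuous (cdf (gaussianReal 0 1)) := by
  have := nullSingletonClass_gaussianReal (μ := 0) (v := 1) one_ne_zero
  refine continuous_iff_continuousAt.2 fun x => ?_
  rw [(monotone_cdf _).continuousAt_iff_leftLim_eq_rightLim, StieltjesFunction.rightLim_eq]
  have h := StieltjesFunction.measure_singleton (cdf (gaussianReal 0 1)) x
  rw [measure_cdf, measure_singleton, eq_comm, ENNReal.ofReal_eq_zero] at h
  exact le_antisymm ((monotone_cdf _).leftLim_le le_rfl) (by linarith)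

lemma gaussianQ_zero : gaussianQ 0 = 1 / 2 := by
  have := nullSingletonClass_gaussianReal (μ := 0) (v := 1) one_ne_zero
  have hneg : (gaussianReal 0 1).real (Iic 0) = gaussianQ 0 := by
    have h : (gaussianReal 0 1).map (fun x => -x) = gaussianReal 0 1 := by
      rw [gaussianReal_map_neg, neg_zero]
    have e : (fun x : ℝ => -x) ⁻¹' Ioi 0 = Iio 0 := by ext; simp
    conv_rhs => rw [gaussianQ, ← h, map_measureReal_apply measurable_neg measurableSet_Ioi, e]
    exact (measureReal_congr Iio_ae_eq_Iic).symm
  have h := gaussianQ_eq_one_sub_cdf 0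
  rw [cdf_eq_real, hneg] at h
  linarith

lemma antitone_gaussianQ : Antitone gaussianQ := fun x y hxy => by
  rw [gaussianQ_eq_one_sub_cdf, gaussianQ_eq_one_sub_cdf]
  linarith [monotone_cdf (gaussianReal 0 1) hxy]

lemma exists_gaussianQ_eq {d : ℝ} (hd0 : 0 < d) (hd1 : d < 1 / 2) : ∃ x, gaussianQ x = d := by
  have hlim : Tendsto gaussianQ atTop (𝓝 (1 - 1)) :=
    (tendsto_const_nhds.sub (tendsto_cdf_atTop (gaussianReal 0 1))).congr
      fun x => (gaussianQ_eq_one_sub_cdf x).symm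
  rw [sub_self] at hlim
  obtain ⟨y, hy⟩ := (hlim.eventually_lt_const hd0).exists
  have hc : Continuous gaussianQ :=
    (continuous_const.sub continuous_cdf_gaussianReal).congr
      fun x => (gaussianQ_eq_one_sub_cdf x).symm
  exact mem_range_of_exists_le_of_exists_ge hc ⟨y, hy.le⟩ ⟨0, by rw [gaussianQ_zero]; exact hd1.le⟩

lemma gaussianQInv_pos {d : ℝ} (hd0 : 0 < d) (hd1 : d < 1 / 2) : 0 < gaussianQInv d := by
  have h : gaussianQ (gaussianQInv d) = d := Function.invFun_eq (exists_gaussianQ_eq hd0 hd1)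
  by_contra! hle
  have := antitone_gaussianQ hle
  rw [h, gaussianQ_zero] at this
  linarith

/-! ### Throughput and blocklength -/

/-- On `(0, S]` the function `a L - b √L` is maximal only at `S`, and at `S` only if it is
non-negative there: where it is negative it stays below its limit `0` at the origin. -/
lemma isMaxOn_Ioc_iff {a b S L : ℝ} (ha : 0 < a) (hb : 0 < b) (hS : 0 < S) :
    (L ∈ Ioc 0 S ∧ ∀ x ∈ Ioc 0 S, a * x - b * √x ≤ a * L - b * √L) ↔
      L = S ∧ 0 ≤ a * L - b * √L := by
  have hfac : ∀ x, 0 ≤ x → a * x - b * √x = √x * (a * √x - b) := fun x hx => by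
    nlinarith [Real.mul_self_sqrt hx]
  constructor
  · rintro ⟨⟨hL0, hLS⟩, hmax⟩
    have hnn : 0 ≤ a * L - b * √L := by
      by_contra! hneg
      set τ := -(a * L - b * √L) with hτ
      have hτ0 : 0 < τ := by linarith
      -- a blocklength so short that its loss `b √x` is at most half of the loss at `L`
      have hx0 : 0 < min L ((τ / (2 * b)) ^ 2) := lt_min hL0 (by positivity)
      have h := hmax _ ⟨hx0, (min_le_left _ _).trans hLS⟩
      have hsq : √(min L ((τ / (2 * b)) ^ 2)) ≤ τ / (2 * b) := by
        rw [← Real.sqrt_sq (show 0 ≤ τ / (2 * b) by positivity)]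
        exact Real.sqrt_le_sqrt ((min_le_right _ _).trans_eq (by
          rw [Real.sqrt_sq (show 0 ≤ τ / (2 * b) by positivity)]))
      have h1 : b * √(min L ((τ / (2 * b)) ^ 2)) ≤ τ / 2 := by
        calc _ ≤ b * (τ / (2 * b)) := by gcongr
          _ = τ / 2 := by field_simp
      have h2 := mul_pos ha hx0
      linarith
    refine ⟨?_, hnn⟩
    by_contra hne
    have hlt : L < S := lt_of_le_of_ne hLS hne
    have h := hmax S ⟨hS, le_rfl⟩
    rw [hfac L hL0.le] at hnn h
    rw [hfac S hS.le] at h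
    have hs := Real.sqrt_lt_sqrt hL0.le hlt
    have hsL := Real.sqrt_pos.2 hL0
    have hr : 0 ≤ a * √L - b := nonneg_of_mul_nonneg_right hnn hsL
    have : a * √L < a * √S := by gcongr
    nlinarith
  · rintro ⟨rfl, hnn⟩
    refine ⟨⟨hS, le_rfl⟩, fun x hx => ?_⟩
    rw [hfac L hS.le] at hnn ⊢
    rw [hfac x hx.1.le]
    have hs := Real.sqrt_le_sqrt hx.2
    have hr : 0 ≤ a * √L - b := nonneg_of_mul_nonneg_right hnn (Real.sqrt_pos.2 hS)
    have h1 : a * √x - b ≤ a * √L - b := by gcongr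
    exact (mul_le_mul_of_nonneg_left h1 (Real.sqrt_nonneg x)).trans
      (mul_le_mul_of_nonneg_right hs hr)

/-- The Shannon capacity per channel use, `log₂ (1 + P |hab|²)`. -/
noncomputable def capacity (hab : ℂ) (P : ℝ) : ℝ := Real.logb 2 (1 + P * ‖hab‖ ^ 2)

/-- The coefficient of the finite-blocklength penalty, the rate being `capacity - penalty / √L`. -/
noncomputable def penalty (d : ℝ) (hab : ℂ) (P : ℝ) : ℝ :=
  √(1 - 1 / (1 + P * ‖hab‖ ^ 2) ^ 2) * (gaussianQInv d / Real.log 2)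

variable {d : ℝ} {hab : ℂ} {L P : ℝ}

lemma one_lt_one_add_mul_norm_sq (hhab : hab ≠ 0) (hP : 0 < P) : 1 < 1 + P * ‖hab‖ ^ 2 := by
  have : 0 < P * ‖hab‖ ^ 2 := by positivity
  linarith

lemma capacity_pos (hhab : hab ≠ 0) (hP : 0 < P) : 0 < capacity hab P :=
  Real.logb_pos one_lt_two (one_lt_one_add_mul_norm_sq hhab hP)

lemma dispersion_pos (hhab : hab ≠ 0) (hP : 0 < P) :
    0 < 1 - 1 / (1 + P * ‖hab‖ ^ 2) ^ 2 := by
  have h := one_lt_one_add_mul_norm_sq hhab hP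
  rw [sub_pos, div_lt_one (by positivity)]
  exact one_lt_pow₀ h two_ne_zero

lemma penalty_pos (hd0 : 0 < d) (hd : d < 1 / 2) (hhab : hab ≠ 0) (hP : 0 < P) :
    0 < penalty d hab P :=
  mul_pos (Real.sqrt_pos.2 (dispersion_pos hhab hP))
    (div_pos (gaussianQInv_pos hd0 hd) (Real.log_pos one_lt_two))

lemma mul_codingRate (hL : 0 < L) :
    L * codingRate d hab L P = capacity hab P * L - penalty d hab P * √L := by
  rw [codingRate, capacity, penalty, Real.sqrt_mul (by positivity), Real.sqrt_div zero_le_one,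
    Real.sqrt_one]
  have h := Real.mul_self_sqrt hL.le
  have hs := Real.sqrt_pos.2 hL
  have e : L * (1 / √L) = √L := by rw [mul_one_div, div_eq_iff hs.ne', h]
  rw [mul_sub, ← mul_assoc, ← mul_assoc, e]
  ring

lemma throughput_le_throughput_iff (hd : d < 1 / 2) {L' P' : ℝ} (hL : 0 < L) (hL' : 0 < L') :
    throughput d hab L P ≤ throughput d hab L' P' ↔
      capacity hab P * L - penalty d hab P * √L ≤ capacity hab P' * L' - penalty d hab P' * √L' := by
  rw [throughput, throughput, mul_le_mul_iff_left₀ (by linarith), mul_codingRate hL,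
    mul_codingRate hL']

lemma codingRate_nonneg_iff (hL : 0 < L) :
    0 ≤ codingRate d hab L P ↔ 0 ≤ capacity hab P * L - penalty d hab P * √L := by
  rw [← mul_codingRate hL, mul_nonneg_iff_of_pos_left hL]

lemma throughput_nonneg (hd : d < 1 / 2) (hL : 0 < L) (hR : 0 ≤ codingRate d hab L P) :
    0 ≤ throughput d hab L P :=
  mul_nonneg (mul_nonneg hL.le hR) (by linarith)

/-- The rate is monotone in the blocklength, so a negative rate at the longest blocklength makes
every throughput negative. -/
lemma throughput_le_max (hd0 : 0 < d) (hd : d < 1 / 2) (hhab : hab ≠ 0) (hP : 0 < P)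
    {S : ℝ} (hL : 0 < L) (hLS : L ≤ S) :
    throughput d hab L P ≤ max 0 (throughput d hab S P) := by
  have hS := hL.trans_le hLS
  by_cases hR : 0 ≤ codingRate d hab S P
  · refine le_max_of_le_right ((throughput_le_throughput_iff hd hL hS).2 ?_)
    exact ((isMaxOn_Ioc_iff (capacity_pos hhab hP) (penalty_pos hd0 hd hhab hP) hS).2
      ⟨rfl, (codingRate_nonneg_iff hS).1 hR⟩).2 L ⟨hL, hLS⟩
  · refine le_max_of_le_left ?_
    have hle : codingRate d hab L P ≤ codingRate d hab S P := by
      unfold codingRate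
      have hq := (gaussianQInv_pos hd0 hd).le
      have hv := (dispersion_pos hhab hP).le
      have hlog := Real.log_pos one_lt_two
      gcongr
    have hR' : codingRate d hab L P ≤ 0 := by linarith
    exact mul_nonpos_of_nonpos_of_nonneg (mul_nonpos_of_nonneg_of_nonpos hL.le hR') (by linarith)

/-- At high power the rate at the longest covert blocklength is non-negative: the capacity grows
like `log P`, while the covert blocklength decays no faster than `1 / log P`. -/
lemma exists_codingRate_Lstar_nonneg (k : ℕ) {lam eps Lmax : ℝ} (hlam : 0 < lam) (heps : 0 < eps)
    (hLmax : 0 < Lmax) (hd0 : 0 < d) (hd : d < 1 / 2) (hhab : hab ≠ 0) :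
    ∃ P, 0 < P ∧ 0 ≤ codingRate d hab (Lstar (k + 1) lam eps Lmax P) P := by
  obtain ⟨C, hC0, hC⟩ := g_le k hlam
  set q := gaussianQInv d with hq
  have hq0 : 0 < q := gaussianQInv_pos hd0 hd
  set κ := ‖hab‖ ^ 2 with hκ
  have hκ0 : 0 < κ := by positivity
  set D := Real.log (1 + 1 / κ) + C with hD
  have hD0 : 0 ≤ D := by
    have : 0 ≤ Real.log (1 + 1 / κ) := Real.log_nonneg (by
      have : 0 < 1 / κ := by positivity
      linarith)
    linarith
  set u := 1 + D + q ^ 2 / eps ^ 2 + q ^ 2 / Lmax with hu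
  have h1 : 0 < q ^ 2 / eps ^ 2 := by positivity
  have h2 : 0 < q ^ 2 / Lmax := by positivity
  have hu1 : 1 ≤ u := by linarith
  -- `u` is the capacity in nats at the power `P`; it exceeds `q ^ 2 / Lmax`, `q ^ 2 / eps ^ 2`
  -- and `D`, where `g ≤ u + D ≤ 2 u`
  set P := (Real.exp u - 1) / κ with hPdef
  have hP : 0 < P := div_pos (by linarith [Real.add_one_le_exp u]) hκ0
  have hPu : 1 + P * κ = Real.exp u := by rw [hPdef]; field_simp; ring
  have hg0 := g_pos k hlam hP
  have hg : g (k + 1) lam P ≤ u + D := by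
    have hle : Real.log (1 + P) ≤ Real.log ((1 + P * κ) * (1 + 1 / κ)) := by
      refine Real.log_le_log (by linarith) ?_
      have e : (1 + P * κ) * (1 + 1 / κ) = 1 + P + (P * κ + 1 / κ) := by field_simp; ring
      rw [e]
      have : 0 < P * κ + 1 / κ := by positivity
      linarith
    rw [Real.log_mul (by positivity) (by positivity), hPu, Real.log_exp] at hle
    linarith [hC P hP]
  have hLs0 : 0 < Lstar (k + 1) lam eps Lmax P := lt_min hLmax (by positivity)
  have hLs : q ^ 2 / u ^ 2 ≤ Lstar (k + 1) lam eps Lmax P := by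
    refine le_min ?_ ?_
    · have h3 : q ^ 2 ≤ u * Lmax := by rw [← div_le_iff₀ hLmax]; linarith
      rw [div_le_iff₀ (by positivity)]
      nlinarith [mul_le_mul_of_nonneg_right hu1 (mul_nonneg (by linarith : 0 ≤ u) hLmax.le)]
    · have h3 : q ^ 2 ≤ u * eps ^ 2 := by rw [← div_le_iff₀ (by positivity)]; linarith
      rw [div_le_div_iff₀ (by positivity) hg0]
      calc q ^ 2 * g (k + 1) lam P ≤ (u * eps ^ 2) * (2 * u) := by
            gcongr
            linarith
        _ = _ := by ring
  refine ⟨P, hP, ?_⟩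
  rw [codingRate, hPu, Real.logb, Real.log_exp]
  have hlog := Real.log_pos one_lt_two
  have hs : √(1 / Lstar (k + 1) lam eps Lmax P * (1 - 1 / Real.exp u ^ 2)) ≤ u / q := by
    refine Real.sqrt_le_iff.2 ⟨by positivity, ?_⟩
    have hv : 1 - 1 / Real.exp u ^ 2 ≤ 1 := by
      have : 0 < 1 / Real.exp u ^ 2 := by positivity
      linarith
    calc _ ≤ 1 / Lstar (k + 1) lam eps Lmax P * 1 := by gcongr
      _ ≤ 1 / (q ^ 2 / u ^ 2) := by rw [mul_one]; gcongr
      _ = (u / q) ^ 2 := by field_simp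
  rw [sub_nonneg]
  calc _ ≤ u / q * (q / Real.log 2) := by gcongr
    _ = u / Real.log 2 := by field_simp

/-! ### The feasible set -/

lemma Lstar_pos (k : ℕ) {lam eps Lmax P : ℝ} (hlam : 0 < lam) (heps : 0 < eps)
    (hLmax : 0 < Lmax) (hP : 0 < P) : 0 < Lstar (k + 1) lam eps Lmax P :=
  lt_min hLmax (div_pos (by positivity) (g_pos k hlam hP))

lemma le_Lstar_iff (k : ℕ) {lam eps Lmax P L : ℝ} (hlam : 0 < lam) (hP : 0 < P) :
    (L * g (k + 1) lam P ≤ 2 * eps ^ 2 ∧ L ≤ Lmax) ↔ L ≤ Lstar (k + 1) lam eps Lmax P := by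
  rw [Lstar, le_min_iff, le_div_iff₀ (g_pos k hlam hP), and_comm]

lemma mem_feasible_iff {Ω : Type*} [MeasurableSpace Ω] {μ : Measure Ω} [IsProbabilityMeasure μ]
    {k : ℕ} {lam eps Lmax P L : ℝ} (hlam : 0 < lam) {h : Ω → Fin (k + 1) → ℂ}
    (hray : IsRayleigh μ h lam) (hP : 0 < P) :
    (L, P) ∈ feasible μ h eps Lmax ↔ L ∈ Ioc 0 (Lstar (k + 1) lam eps Lmax P) := by
  simp only [feasible, mem_ofPred_eq, mem_Ioc, hP, true_and]
  refine and_congr_right fun hL => ?_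
  rw [expectedKL_eq hlam hray hP, ← ENNReal.ofReal_mul hL.le,
    ENNReal.ofReal_le_ofReal_iff (by positivity), Nat.cast_one, one_mul, le_Lstar_iff k hlam hP]

end Covert

theorem proposition1 {Ω : Type*} [MeasurableSpace Ω] (μ : Measure Ω) [IsProbabilityMeasure μ]
    (M : ℕ) (hM : 1 ≤ M) (lam : ℝ) (hlam : 0 < lam)
    (h : Ω → Fin M → ℂ) (hray : Covert.IsRayleigh μ h lam)
    (hab : ℂ) (hhab : hab ≠ 0) (d : ℝ) (hd0 : 0 < d) (hd : d < 1 / 2)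
    (eps : ℝ) (heps : 0 < eps) (Lmax : ℝ) (hLmax : 0 < Lmax) :
    -- the squared norm of the channel has the Erlang distribution
    HasLaw (fun ω => Covert.normSqVec (h ω)) (gammaMeasure M lam) μ ∧
    -- the closed form of the expected divergence
    (∀ P : ℝ, 0 < P →
      (Covert.meijerTerm M lam P).im = 0 ∧ 0 < Covert.g M lam P ∧
      ∀ n : ℕ, Covert.expectedKL μ h P n = ENNReal.ofReal (n * Covert.g M lam P)) ∧
    -- the two constraints say that the blocklength is at most `Lstar`
    (∀ P : ℝ, 0 < P →
      (∀ n : ℕ, (Covert.expectedKL μ h P n ≤ ENNReal.ofReal (2 * eps ^ 2) ∧ (n : ℝ) ≤ Lmax) ↔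
        (n : ℝ) ≤ Covert.Lstar M lam eps Lmax P) ∧
      ∀ L : ℝ, 0 < L →
        ((L, P) ∈ Covert.feasible μ h eps Lmax ↔ L ≤ Covert.Lstar M lam eps Lmax P)) ∧
    -- the optimal blocklength for a given power
    (∀ P : ℝ, 0 < P → ∀ L : ℝ,
      ((L, P) ∈ Covert.feasible μ h eps Lmax ∧
        IsMaxOn (fun L' => Covert.throughput d hab L' P)
          {L' | (L', P) ∈ Covert.feasible μ h eps Lmax} L) ↔
      (L = Covert.Lstar M lam eps Lmax P ∧ 0 ≤ Covert.codingRate d hab L P)) ∧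
    -- the joint problem reduces to the one-dimensional problem in the power
    (∀ L P : ℝ,
      ((L, P) ∈ Covert.feasible μ h eps Lmax ∧
        IsMaxOn (fun x : ℝ × ℝ => Covert.throughput d hab x.1 x.2)
          (Covert.feasible μ h eps Lmax) (L, P)) ↔
      (L = Covert.Lstar M lam eps Lmax P ∧ 0 < P ∧
        IsMaxOn (fun P' => Covert.throughput d hab (Covert.Lstar M lam eps Lmax P') P')
          (Ioi 0) P)) := by
  obtain ⟨k, rfl⟩ : ∃ k, M = k + 1 := ⟨M - 1, by omega⟩
  have hfeas : ∀ {P L : ℝ}, 0 < P → ((L, P) ∈ Covert.feasible μ h eps Lmax ↔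
      L ∈ Ioc 0 (Covert.Lstar (k + 1) lam eps Lmax P)) :=
    fun hP => Covert.mem_feasible_iff hlam hray hP
  have hLs : ∀ {P : ℝ}, 0 < P → 0 < Covert.Lstar (k + 1) lam eps Lmax P :=
    fun hP => Covert.Lstar_pos k hlam heps hLmax hP
  have hslice : ∀ P : ℝ, 0 < P → ∀ L : ℝ,
      ((L, P) ∈ Covert.feasible μ h eps Lmax ∧
        IsMaxOn (fun L' => Covert.throughput d hab L' P)
          {L' | (L', P) ∈ Covert.feasible μ h eps Lmax} L) ↔
      (L = Covert.Lstar (k + 1) lam eps Lmax P ∧ 0 ≤ Covert.codingRate d hab L P) := by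
    intro P hP L
    have hmax := Covert.isMaxOn_Ioc_iff (L := L) (Covert.capacity_pos hhab hP)
      (Covert.penalty_pos hd0 hd hhab hP) (hLs hP)
    simp only [isMaxOn_iff, mem_ofPred_eq, hfeas hP]
    constructor
    · rintro ⟨hL, hm⟩
      rw [Covert.codingRate_nonneg_iff hL.1]
      exact hmax.1 ⟨hL, fun x hx =>
        (Covert.throughput_le_throughput_iff hd hx.1 hL.1).1 (hm x hx)⟩
    · rintro ⟨rfl, hR⟩
      obtain ⟨hL, hm⟩ := hmax.2 ⟨rfl, (Covert.codingRate_nonneg_iff (hLs hP)).1 hR⟩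
      exact ⟨hL, fun x hx => (Covert.throughput_le_throughput_iff hd hx.1 hL.1).2 (hm x hx)⟩
  refine ⟨Covert.hasLaw_normSqVec hlam hray, fun P hP => ⟨?_, Covert.g_pos k hlam hP,
    fun n => Covert.expectedKL_eq hlam hray hP n⟩, fun P hP => ⟨fun n => ?_, fun L hL => ?_⟩,
    hslice, fun L P => ⟨?_, ?_⟩⟩
  · rw [Covert.meijerTerm_eq k hlam hP, Complex.ofReal_im]
  · rw [Covert.expectedKL_eq hlam hray hP, ENNReal.ofReal_le_ofReal_iff (by positivity),
      Covert.le_Lstar_iff k hlam hP]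
  · rw [hfeas hP, mem_Ioc, and_iff_right hL]
  · rintro ⟨hmem, hmax⟩
    have hP : 0 < P := hmem.2.1
    have hL := ((hslice P hP L).1 ⟨hmem, fun L' hL' => hmax hL'⟩).1
    refine ⟨hL, hP, fun P' hP' => ?_⟩
    have := hmax ((hfeas hP').2 ⟨hLs hP', le_rfl⟩)
    rwa [hL] at this
  · rintro ⟨rfl, hP, hmax⟩
    refine ⟨(hfeas hP).2 ⟨hLs hP, le_rfl⟩, fun x hx => ?_⟩
    obtain ⟨L', P'⟩ := x
    have hP' : 0 < P' := hx.2.1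
    have hL' := (hfeas hP').1 hx
    -- a negative optimal value would be beaten by ever shorter blocklengths, but it cannot occur:
    -- some power attains a non-negative throughput
    obtain ⟨P₀, hP₀, hR₀⟩ :=
      Covert.exists_codingRate_Lstar_nonneg k hlam heps hLmax hd0 hd hhab
    have h0 : 0 ≤ Covert.throughput d hab (Covert.Lstar (k + 1) lam eps Lmax P) P :=
      (Covert.throughput_nonneg hd (hLs hP₀) hR₀).trans (hmax hP₀)
    exact (Covert.throughput_le_max hd0 hd hhab hP' hL'.1 hL'.2).trans
      (max_le h0 (hmax hP'))
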